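/- **Theorem 1.5.** Let $n\ge 1$, let $a_1,\dots,a_{n-1}\in\mathbb Z$, and let $\sigma,\tau>0$ be real numbers with $\tau+a_j\sigma>0$ for all $j<n$. Let $M_\Delta$ be the closed symplectic toric $2n$-manifold obtained as the quotient of $$\Big\{z\in\mathbb C^{n+2}:\ \sum_{j=1}^{n-1}|z_j|^2+|z_{n+1}|^2=\frac{\sigma}{\pi},\quad -\sum_{j=1}^{n-1}a_j|z_j|^2+|z_n|^2+|z_{n+2}|^2=\frac{\tau}{\pi}\Big\}$$ by the action of $U(1)^2$ in which $(\lambda,\epsilon)$ sends $z_j\mapsto\lambda\epsilon^{-a_j}z_j$ $(j<n)$, $z_{n+1}\mapsto\lambda z_{n+1}$, $z_n\mapsto\epsilon z_n$, $z_{n+2}\mapsto\epsilon z_{n+2}$, with the symplectic form $\omega$ induced by $\sum_j dx_j\wedge dy_j$ on $\mathbb C^{n+2}$ $(z_j=x_j+iy_j)$. (As a manifold, $M_\Delta$ is the total space of $\mathbb P(L_1\oplus\dots\oplus L_{n-1}\oplus\mathbb C)\to\mathbb CP^1$, where $L_j$ is the holomorphic line bundle of first Chern number $-a_j$.) For $\mathbf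 b=(b_1,\dots,b_n)\in\mathbb Z^n$ let $\psi_{\mathbf b}$ be the action of $U(1)$ on $M_\Delta$ given by $$\psi_{\mathbf b}(c)[z]=[c^{b_1}z_1,\dots,c^{b_n}z_n,z_{n+1},z_{n+2}],\qquad c\in U(1).$$ Let $\mathbf b,\mathbf b'\in\mathbb Z^n$ be such that either $\mathbf b=\mathbf b'$, or $b'_j=b_j+a_jb_n$ for all $j<n$ and $b'_n=-b_n$. Then $\psi_{\mathbf b}$ and $\psi_{\mathbf b'}$ are homotopic through Hamiltonian circle actions: there is a family $\{\psi^s:U(1)\to\mathrm{Ham}(M_\Delta,\omega)\}_{s\in[0,1]}$ of Lie group homomorphisms (group homomorphisms for which the action map $U(1)\times M_\Delta\to M_\Delta$ is smooth), continuous as a map $[0,1]\times U(1)\to\mathrm{Ham}(M_\Delta,\omega)$ for the $C^\infty$ topology on the group $\mathrm{Ham}(M_\Delta,\omega)$ of Hamiltonian diffeomorphisms, with $\psi^0=\psi_{\mathbf b}$ and $\psi^1=\psi_{\mathbf b'}$. -/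

import Mathlib

open scoped Manifold ContDiff ComplexConjugate

noncomputable section

namespace HamTorus

/-! ### Hamiltonian diffeomorphisms and Hamiltonian circle actions

`M` is a smooth manifold modelled on the real normed space `E`, and `Ω` is a field of bilinear
forms on its tangent spaces (a symplectic form in the application below). -/

section General

variable {E : Type*} [NormedAddCommGroup E] [NormedSpace ℝ E]
  {M : Type*} [TopologicalSpace M] [ChartedSpace E M]

/-- `φ` is a Hamiltonian diffeomorphism of `(M, Ω)`: it is the time-one map of a smooth isotopy
`Φ_t` starting at the identity and generated by a smooth time-dependent function `H_t`, that is,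
`Ω (dΦ_t/dt, v) = dH_t (v)` for all tangent vectors `v` at `Φ_t x`. -/
def IsHamiltonian (Ω : ∀ x : M, LinearMap.BilinForm ℝ (TangentSpace 𝓘(ℝ, E) x))
    (φ : M ≃ₘ⟮𝓘(ℝ, E), 𝓘(ℝ, E)⟯ M) : Prop :=
  ∃ (Φ : ℝ → (M ≃ₘ⟮𝓘(ℝ, E), 𝓘(ℝ, E)⟯ M)) (H : ℝ → M → ℝ),
    ContMDiff (𝓘(ℝ, ℝ).prod 𝓘(ℝ, E)) 𝓘(ℝ, E) ∞ (fun p : ℝ × M => Φ p.1 p.2) ∧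
    ContMDiff (𝓘(ℝ, ℝ).prod 𝓘(ℝ, E)) 𝓘(ℝ, ℝ) ∞ (fun p : ℝ × M => H p.1 p.2) ∧
    (∀ x, Φ 0 x = x) ∧ (∀ x, Φ 1 x = φ x) ∧
    ∀ (t : ℝ) (x : M) (v : TangentSpace 𝓘(ℝ, E) (Φ t x)),
      Ω (Φ t x) (mfderiv 𝓘(ℝ, ℝ) 𝓘(ℝ, E) (fun s : ℝ => Φ s x) t (1 : ℝ)) v =
        mfderiv 𝓘(ℝ, E) 𝓘(ℝ, ℝ) (H t) (Φ t x) v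

/-- The Hamiltonian group `Ham(M, Ω)` (as a set of diffeomorphisms of `M`). -/
def Ham (Ω : ∀ x : M, LinearMap.BilinForm ℝ (TangentSpace 𝓘(ℝ, E) x)) : Type _ :=
  {φ : M ≃ₘ⟮𝓘(ℝ, E), 𝓘(ℝ, E)⟯ M // IsHamiltonian Ω φ}

/-- The standard subbasic neighbourhood of `f` in the `C^∞` topology: all diffeomorphisms `g`
that map the compact set `K`, contained in the domain of the chart `c`, into the domain of the
chart `c'`, and whose derivatives of order `≤ r` in these charts are `ε`-close to those of `f`
on `K`. -/
def smoothNhd (f : M ≃ₘ⟮𝓘(ℝ, E), 𝓘(ℝ, E)⟯ M) (c c' : OpenPartialHomeomorph M E) (K : Set M)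
    (r : ℕ) (ε : ℝ) : Set (M ≃ₘ⟮𝓘(ℝ, E), 𝓘(ℝ, E)⟯ M) :=
  {g | Set.MapsTo g K c'.source ∧ ∀ j ≤ r, ∀ y ∈ c '' K,
    ‖iteratedFDeriv ℝ j (fun p => c' (f (c.symm p))) y -
      iteratedFDeriv ℝ j (fun p => c' (g (c.symm p))) y‖ < ε}

/-- The `C^∞` topology (uniform convergence of all derivatives on compact sets) on the set of
diffeomorphisms of `M`. -/
abbrev smoothTopology : TopologicalSpace (M ≃ₘ⟮𝓘(ℝ, E), 𝓘(ℝ, E)⟯ M) :=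
  TopologicalSpace.generateFrom
    {N | ∃ (f : M ≃ₘ⟮𝓘(ℝ, E), 𝓘(ℝ, E)⟯ M) (c c' : OpenPartialHomeomorph M E) (K : Set M)
      (r : ℕ) (ε : ℝ), c ∈ IsManifold.maximalAtlas 𝓘(ℝ, E) ∞ M ∧
      c' ∈ IsManifold.maximalAtlas 𝓘(ℝ, E) ∞ M ∧ IsCompact K ∧ K ⊆ c.source ∧
      Set.MapsTo f K c'.source ∧ 0 < ε ∧ N = smoothNhd f c c' K r ε}

/-- `Ham(M, Ω)` carries the `C^∞` topology. -/
instance (Ω : ∀ x : M, LinearMap.BilinForm ℝ (TangentSpace 𝓘(ℝ, E) x)) :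
    TopologicalSpace (Ham Ω) :=
  TopologicalSpace.induced Subtype.val smoothTopology

/-- A Hamiltonian circle action on `(M, Ω)`: a homomorphism `U(1) → Ham(M, Ω)` which is smooth,
in the sense that `U(1) × M → M` is a smooth map. -/
structure HamAction (Ω : ∀ x : M, LinearMap.BilinForm ℝ (TangentSpace 𝓘(ℝ, E) x)) where
  toFun : Circle → Ham Ω
  map_one : ∀ x, (toFun 1).1 x = x
  map_mul : ∀ g h x, (toFun (g * h)).1 x = (toFun g).1 ((toFun h).1 x)
  smooth : ContMDiff ((𝓡 1).prod 𝓘(ℝ, E)) 𝓘(ℝ, E) ∞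
    (fun p : Circle × M => (toFun p.1).1 p.2)

/-- The relation `ψ ∼ ψ'`: `ψ` and `ψ'` are Hamiltonian circle actions which are joined by a family
`Ψ^s`, `s ∈ [0, 1]`, of Hamiltonian circle actions, continuous as a map
`[0, 1] × U(1) → Ham(M, Ω)`. -/
def HomotopicThroughActions (Ω : ∀ x : M, LinearMap.BilinForm ℝ (TangentSpace 𝓘(ℝ, E) x))
    (ψ ψ' : Circle → M → M) : Prop :=
  ∃ Ψ : unitInterval → HamAction Ω,
    Continuous (fun p : unitInterval × Circle => (Ψ p.1).toFun p.2) ∧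
    (∀ g x, ((Ψ 0).toFun g).1 x = ψ g x) ∧ (∀ g x, ((Ψ 1).toFun g).1 x = ψ' g x)

end General

/-! ### The toric manifold

Throughout `n = m + 1`. A point `z = (z_1, …, z_{n+2})` of `ℂ^{n+2}` is written `(u, w)` with
`u = (z_1, …, z_{n-1}, z_{n+1})` and `w = (z_n, z_{n+2})`. -/

/-- The data that determine the Delzant polytope: the integers `a_1, …, a_{n-1}` and the real
numbers `σ, τ > 0` with `τ + a_j σ > 0`. -/
structure PolytopeData (m : ℕ) where
  a : Fin m → ℤ
  σ : ℝ
  τ : ℝ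
  σ_pos : 0 < σ
  τ_pos : 0 < τ
  pos : ∀ j, 0 < τ + a j * σ

/-- The ambient space `ℂ^{n+2}`. -/
abbrev Amb (m : ℕ) : Type := (Fin (m + 1) → ℂ) × (Fin 2 → ℂ)

/-- The model space `ℂ^n`. -/
abbrev Model (m : ℕ) : Type := (Fin m → ℂ) × ℂ

/-- The standard symplectic form `(i/2) ∑ dz_j ∧ dz̄_j = ∑ dx_j ∧ dy_j` of `ℂ^{n+2}`. -/
def stdForm (m : ℕ) : LinearMap.BilinForm ℝ (Amb m) :=
  LinearMap.mk₂ ℝ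
    (fun z z' => ∑ l, (conj (z.1 l) * z'.1 l).im + ∑ k, (conj (z.2 k) * z'.2 k).im)
    (fun x y z => by
      simp only [Prod.fst_add, Prod.snd_add, Pi.add_apply, map_add, add_mul, Complex.add_im,
        Finset.sum_add_distrib]
      ring)
    (fun c x y => by
      simp only [Prod.smul_fst, Prod.smul_snd, Pi.smul_apply, Complex.real_smul, map_mul,
        Complex.conj_ofReal, mul_assoc, Complex.im_ofReal_mul, smul_eq_mul,
        ← Finset.mul_sum, mul_add])
    (fun x y z => by
      simp only [Prod.fst_add, Prod.snd_add, Pi.add_apply, mul_add, Complex.add_im,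
        Finset.sum_add_distrib]
      ring)
    (fun c x y => by
      simp only [Prod.smul_fst, Prod.smul_snd, Pi.smul_apply, Complex.real_smul,
        mul_left_comm _ (c : ℂ), Complex.im_ofReal_mul, smul_eq_mul,
        ← Finset.mul_sum, mul_add])

namespace PolytopeData

variable {m : ℕ} (D : PolytopeData m)

/-- The integers `a_1, …, a_{n-1}` completed by `0`, the exponent belonging to `z_{n+1}`. -/
def wt : Fin (m + 1) → ℤ := Fin.snoc (α := fun _ => ℤ) D.a 0

/-- The level set in `ℂ^{n+2}` given by `∑' |z_j|² = σ/π` and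
`-∑_{j<n} a_j |z_j|² + |z_n|² + |z_{n+2}|² = τ/π`. -/
def Level : Set (Amb m) :=
  {z | ∑ l, ‖z.1 l‖ ^ 2 = D.σ / Real.pi ∧
    -∑ l, (D.wt l : ℝ) * ‖z.1 l‖ ^ 2 + ∑ k, ‖z.2 k‖ ^ 2 = D.τ / Real.pi}

/-- The action of `(lam, ε) ∈ U(1)²` on `ℂ^{n+2}`: `z_j ↦ lam ε^{-a_j} z_j` for `j < n`,
`z_{n+1} ↦ lam z_{n+1}`, and `z_k ↦ ε z_k` for `k = n, n + 2`. -/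
def gaugeAct (lam ε : Circle) (z : Amb m) : Amb m :=
  (fun l => (lam : ℂ) * (ε : ℂ) ^ (-D.wt l) * z.1 l, fun k => (ε : ℂ) * z.2 k)

theorem gaugeAct_one (z : Amb m) : D.gaugeAct 1 1 z = z := by
  simp [gaugeAct]

theorem gaugeAct_mul (l₁ e₁ l₂ e₂ : Circle) (z : Amb m) :
    D.gaugeAct l₁ e₁ (D.gaugeAct l₂ e₂ z) = D.gaugeAct (l₁ * l₂) (e₁ * e₂) z := by
  refine Prod.ext (funext fun l => ?_) (funext fun k => ?_)
  · simp only [gaugeAct, Circle.coe_mul, mul_zpow]; ring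
  · simp only [gaugeAct, Circle.coe_mul]; ring

/-- The equivalence relation on the level set: being in the same orbit of `U(1)²`. -/
def orbitSetoid : Setoid D.Level where
  r z z' := ∃ lam ε : Circle, z'.1 = D.gaugeAct lam ε z.1
  iseqv :=
    { refl := fun z => ⟨1, 1, (D.gaugeAct_one z.1).symm⟩
      symm := by
        rintro z z' ⟨l, e, h⟩
        exact ⟨l⁻¹, e⁻¹, by rw [h, gaugeAct_mul]; simp [gaugeAct_one]⟩
      trans := by
        rintro z z' z'' ⟨l, e, h⟩ ⟨l', e', h'⟩
        exact ⟨l' * l, e' * e, by rw [h', h, gaugeAct_mul]⟩ }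

/-- The toric manifold `M_Δ`: the quotient of the level set by `U(1)²`. -/
def Toric : Type := Quotient D.orbitSetoid

instance : TopologicalSpace D.Toric := inferInstanceAs (TopologicalSpace (Quotient D.orbitSetoid))

/-- The quotient map, `z ↦ [z]`. -/
def proj (z : D.Level) : D.Toric := Quotient.mk D.orbitSetoid z

theorem isQuotientMap_proj : Topology.IsQuotientMap D.proj := isQuotientMap_quotient_mk'

/-! #### The smooth structure

On the open set `{z_i ≠ 0, z_k ≠ 0}` with `i ∈ {1, …, n-1, n+1}` and `k ∈ {n, n+2}`, each class
has a unique representative with `z_i > 0` and `z_k > 0`. The remaining `n` complex coordinates of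
that representative form a chart. -/

/-- The unit complex number that makes `z` positive (`0` if `z = 0`). -/
def phase (z : ℂ) : ℂ := conj z / (‖z‖ : ℂ)

theorem phase_mul_self (z : ℂ) : phase z * z = ‖z‖ := by
  by_cases h : z = 0
  · simp [h, phase]
  · have : (‖z‖ : ℂ) ≠ 0 := by simpa using h
    rw [phase, div_mul_eq_mul_div, Complex.conj_mul', div_eq_iff this]
    ring

theorem norm_phase {z : ℂ} (h : z ≠ 0) : ‖phase z‖ = 1 := by
  rw [phase, norm_div, RCLike.norm_conj, Complex.norm_real, norm_norm,
    div_self (norm_ne_zero_iff.2 h)]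

theorem phase_mul (z z' : ℂ) : phase (z * z') = phase z * phase z' := by
  simp [phase, mul_div_mul_comm]

theorem phase_circle (c : Circle) : phase (c : ℂ) = (c : ℂ)⁻¹ := by
  simp [phase, ← Circle.coe_inv_eq_conj, Circle.norm_coe]

theorem phase_circle_zpow (c : Circle) (d : ℤ) : phase ((c : ℂ) ^ d) = ((c : ℂ) ^ d)⁻¹ := by
  rw [← Circle.coe_zpow, phase_circle]

theorem phase_ofReal {r : ℝ} (h : 0 < r) : phase (r : ℂ) = 1 := by
  have : (r : ℂ) ≠ 0 := by exact_mod_cast h.ne'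
  simp [phase, abs_of_pos h, this]

theorem contDiffAt_phase {z : ℂ} (h : z ≠ 0) : ContDiffAt ℝ ∞ phase z := by
  have h1 : ContDiffAt ℝ ∞ (fun z : ℂ => conj z) z := Complex.conjCLE.contDiff.contDiffAt
  have h2 : ContDiffAt ℝ ∞ (fun z : ℂ => ((‖z‖ : ℝ) : ℂ)) z :=
    Complex.ofRealCLM.contDiff.contDiffAt.comp z (contDiffAt_norm ℝ h)
  have e : phase = fun z : ℂ => conj z * ((‖z‖ : ℝ) : ℂ)⁻¹ :=
    funext fun z => div_eq_mul_inv _ _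
  rw [e]
  exact h1.mul (h2.inv (Complex.ofReal_ne_zero.2 (norm_ne_zero_iff.2 h)))

theorem contDiffAt_zpow {z : ℂ} (h : z ≠ 0) (d : ℤ) : ContDiffAt ℝ ∞ (fun z : ℂ => z ^ d) z := by
  cases d with
  | ofNat d => simpa using (contDiff_id (𝕜 := ℝ) (E := ℂ)).pow d |>.contDiffAt
  | negSucc d =>
    simp only [zpow_negSucc]
    exact ((contDiff_id (𝕜 := ℝ) (E := ℂ)).pow (d + 1)).contDiffAt.inv (pow_ne_zero _ h)

/-- The coordinates, other than the `i`-th and `k`-th, of the representative of `[z]` with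
`z_i > 0` and `z_k > 0`. -/
def coord (i : Fin (m + 1)) (k : Fin 2) (z : Amb m) : Model m :=
  (fun l => phase (z.2 k) ^ (D.wt i - D.wt (i.succAbove l)) * phase (z.1 i) *
      z.1 (i.succAbove l),
    phase (z.2 k) * z.2 (k.succAbove 0))

/-- The point of `ℂ^{n+2}` with positive `i`-th and `k`-th coordinates, determined by the equations
of the level set, and with the other coordinates given by `p`. -/
def sec (i : Fin (m + 1)) (k : Fin 2) (p : Model m) : Amb m :=
  let u : Fin (m + 1) → ℂ := i.insertNth (α := fun _ => ℂ)
    ((√(D.σ / Real.pi - ∑ l, ‖p.1 l‖ ^ 2) : ℝ) : ℂ) p.1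
  (u, k.insertNth (α := fun _ => ℂ)
    ((√(D.τ / Real.pi + ∑ l, (D.wt l : ℝ) * ‖u l‖ ^ 2 - ‖p.2‖ ^ 2) : ℝ) : ℂ) (fun _ => p.2))

/-- The domain of the section `sec`. -/
def chartTarget (i : Fin (m + 1)) (k : Fin 2) : Set (Model m) :=
  {p | 0 < D.σ / Real.pi - ∑ l, ‖p.1 l‖ ^ 2 ∧
    0 < D.τ / Real.pi + ∑ l, (D.wt l : ℝ) * ‖(D.sec i k p).1 l‖ ^ 2 - ‖p.2‖ ^ 2}

theorem sec_fst_same (i : Fin (m + 1)) (k : Fin 2) (p : Model m) :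
    (D.sec i k p).1 i = ((√(D.σ / Real.pi - ∑ l, ‖p.1 l‖ ^ 2) : ℝ) : ℂ) := by
  simp [sec]

theorem sec_fst_succAbove (i : Fin (m + 1)) (k : Fin 2) (p : Model m) (l : Fin m) :
    (D.sec i k p).1 (i.succAbove l) = p.1 l := by
  simp [sec]

theorem sec_snd_same (i : Fin (m + 1)) (k : Fin 2) (p : Model m) :
    (D.sec i k p).2 k = ((√(D.τ / Real.pi + ∑ l, (D.wt l : ℝ) * ‖(D.sec i k p).1 l‖ ^ 2
      - ‖p.2‖ ^ 2) : ℝ) : ℂ) := by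
  simp [sec]

theorem sec_snd_succAbove (i : Fin (m + 1)) (k : Fin 2) (p : Model m) (j : Fin 1) :
    (D.sec i k p).2 (k.succAbove j) = p.2 := by
  simp [sec]

theorem sec_mem (i : Fin (m + 1)) (k : Fin 2) {p : Model m} (hp : p ∈ D.chartTarget i k) :
    D.sec i k p ∈ D.Level := by
  constructor
  · rw [Fin.sum_univ_succAbove _ i, sec_fst_same]
    simp only [sec_fst_succAbove, Complex.norm_real, Real.norm_eq_abs, sq_abs]
    rw [Real.sq_sqrt hp.1.le]
    ring
  · rw [Fin.sum_univ_succAbove (fun j => ‖(D.sec i k p).2 j‖ ^ 2) k, sec_snd_same]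
    simp only [sec_snd_succAbove, Complex.norm_real, Real.norm_eq_abs, sq_abs]
    rw [Real.sq_sqrt hp.2.le]
    simp

theorem wt_pos (i : Fin (m + 1)) : 0 < D.τ + D.wt i * D.σ := by
  refine Fin.lastCases ?_ (fun j => ?_) i
  · simpa [wt] using D.τ_pos
  · simpa [wt] using D.pos j

theorem zero_mem (i : Fin (m + 1)) (k : Fin 2) : (0 : Model m) ∈ D.chartTarget i k := by
  have h1 : 0 < D.σ / Real.pi := div_pos D.σ_pos Real.pi_pos
  refine ⟨by simpa using h1, ?_⟩
  rw [Fin.sum_univ_succAbove _ i, sec_fst_same]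
  simp only [sec_fst_succAbove, Complex.norm_real, Real.norm_eq_abs, sq_abs]
  rw [Real.sq_sqrt (by simpa using h1.le)]
  have := div_pos (D.wt_pos i) Real.pi_pos
  simp
  calc (0 : ℝ) < _ := this
    _ = _ := by ring

theorem sec_ne_zero (i : Fin (m + 1)) (k : Fin 2) {p : Model m} (hp : p ∈ D.chartTarget i k) :
    (D.sec i k p).1 i ≠ 0 ∧ (D.sec i k p).2 k ≠ 0 := by
  rw [sec_fst_same, sec_snd_same]
  exact ⟨by exact_mod_cast (Real.sqrt_pos.2 hp.1).ne',
    by exact_mod_cast (Real.sqrt_pos.2 hp.2).ne'⟩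

theorem coord_sec (i : Fin (m + 1)) (k : Fin 2) {p : Model m} (hp : p ∈ D.chartTarget i k) :
    D.coord i k (D.sec i k p) = p := by
  have h1 : phase ((D.sec i k p).1 i) = 1 := by
    rw [sec_fst_same]; exact phase_ofReal (Real.sqrt_pos.2 hp.1)
  have h2 : phase ((D.sec i k p).2 k) = 1 := by
    rw [sec_snd_same]; exact phase_ofReal (Real.sqrt_pos.2 hp.2)
  refine Prod.ext (funext fun l => ?_) ?_
  · simp [coord, h1, h2, sec_fst_succAbove]
  · simp only [coord, h2, one_mul, sec_snd_succAbove]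

theorem coord_gaugeAct (i : Fin (m + 1)) (k : Fin 2) (lam ε : Circle) (z : Amb m) :
    D.coord i k (D.gaugeAct lam ε z) = D.coord i k z := by
  have hl : (lam : ℂ) ≠ 0 := Circle.coe_ne_zero lam
  have he : (ε : ℂ) ≠ 0 := Circle.coe_ne_zero ε
  refine Prod.ext (funext fun l => ?_) ?_
  · simp only [coord, gaugeAct, phase_mul, phase_circle, phase_circle_zpow, mul_zpow, inv_zpow]
    rw [zpow_sub₀ he, zpow_neg, zpow_neg]
    have h1 := zpow_ne_zero (D.wt i) he
    have h2 := zpow_ne_zero (D.wt (i.succAbove l)) he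
    field_simp
  · simp only [coord, gaugeAct, phase_mul, phase_circle]
    field_simp

/-- The element of `U(1)` given by `phase z`. -/
def phaseCircle (z : ℂ) (h : z ≠ 0) : Circle :=
  ⟨phase z, mem_sphere_zero_iff_norm.2 (norm_phase h)⟩

theorem coe_phaseCircle (z : ℂ) (h : z ≠ 0) : (phaseCircle z h : ℂ) = phase z := rfl

theorem coord_eq (i : Fin (m + 1)) (k : Fin 2) (z : Amb m) (hi : z.1 i ≠ 0) (hk : z.2 k ≠ 0) :
    ∃ lam ε : Circle, (D.gaugeAct lam ε z).1 i = ‖z.1 i‖ ∧ (D.gaugeAct lam ε z).2 k = ‖z.2 k‖ ∧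
      (∀ l, (D.gaugeAct lam ε z).1 (i.succAbove l) = (D.coord i k z).1 l) ∧
      (D.gaugeAct lam ε z).2 (k.succAbove 0) = (D.coord i k z).2 := by
  have he : phase (z.2 k) ≠ 0 := by
    intro h; have := norm_phase hk; simp [h] at this
  refine ⟨phaseCircle _ hk ^ D.wt i * phaseCircle _ hi, phaseCircle _ hk, ?_, ?_, ?_, ?_⟩
  · simp only [gaugeAct, Circle.coe_mul, Circle.coe_zpow, coe_phaseCircle]
    rw [zpow_neg, ← phase_mul_self (z.1 i)]
    have h1 := zpow_ne_zero (D.wt i) he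
    field_simp
  · simp only [gaugeAct, coe_phaseCircle]
    exact phase_mul_self _
  · intro l
    simp only [gaugeAct, coord, Circle.coe_mul, Circle.coe_zpow, coe_phaseCircle]
    rw [zpow_sub₀ he, zpow_neg]
    ring
  · simp only [gaugeAct, coord, coe_phaseCircle]

theorem norm_gaugeAct (lam ε : Circle) (z : Amb m) :
    (∀ l, ‖(D.gaugeAct lam ε z).1 l‖ = ‖z.1 l‖) ∧ ∀ k, ‖(D.gaugeAct lam ε z).2 k‖ = ‖z.2 k‖ := by
  constructor <;> intro l <;> simp [gaugeAct, Circle.norm_coe]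

theorem gaugeAct_mem (lam ε : Circle) {z : Amb m} (hz : z ∈ D.Level) :
    D.gaugeAct lam ε z ∈ D.Level := by
  obtain ⟨h1, h2⟩ := D.norm_gaugeAct lam ε z
  simpa only [Level, Set.mem_ofPred_eq, h1, h2] using hz

theorem sec_coord (i : Fin (m + 1)) (k : Fin 2) {z : Amb m} (hz : z ∈ D.Level)
    (hi : z.1 i ≠ 0) (hk : z.2 k ≠ 0) :
    D.coord i k z ∈ D.chartTarget i k ∧
      ∃ lam ε : Circle, D.sec i k (D.coord i k z) = D.gaugeAct lam ε z := by
  obtain ⟨lam, ε, g1, g2, g3, g4⟩ := D.coord_eq i k z hi hk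
  have hz' := D.gaugeAct_mem lam ε hz
  set y := D.gaugeAct lam ε z
  set p := D.coord i k z
  have e1 : D.σ / Real.pi - ∑ l, ‖p.1 l‖ ^ 2 = ‖z.1 i‖ ^ 2 := by
    rw [← hz'.1, Fin.sum_univ_succAbove _ i]
    simp [g1, g3]
  have f1 : (D.sec i k p).1 = y.1 := by
    funext l
    refine Fin.succAboveCases i ?_ (fun j => ?_) l
    · rw [sec_fst_same, e1, g1, Real.sqrt_sq (norm_nonneg _)]
    · rw [sec_fst_succAbove, g3]
  have e2 : D.τ / Real.pi + ∑ l, (D.wt l : ℝ) * ‖(D.sec i k p).1 l‖ ^ 2 - ‖p.2‖ ^ 2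
      = ‖z.2 k‖ ^ 2 := by
    rw [← hz'.2, Fin.sum_univ_succAbove (fun j => ‖y.2 j‖ ^ 2) k, f1]
    simp [g2, g4]
  refine ⟨⟨?_, ?_⟩, lam, ε, Prod.ext f1 (funext fun l => ?_)⟩
  · rw [e1]; exact pow_pos (norm_pos_iff.2 hi) 2
  · rw [e2]; exact pow_pos (norm_pos_iff.2 hk) 2
  · refine Fin.succAboveCases k ?_ (fun j => ?_) l
    · rw [sec_snd_same, e2, g2, Real.sqrt_sq (norm_nonneg _)]
    · rw [sec_snd_succAbove, Subsingleton.elim j 0, g4]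

/-- The part of the ambient space where the chart is defined. -/
def ambSource (i : Fin (m + 1)) (k : Fin 2) : Set (Amb m) := {z | z.1 i ≠ 0 ∧ z.2 k ≠ 0}

theorem isOpen_ambSource (i : Fin (m + 1)) (k : Fin 2) :
    IsOpen (ambSource i k : Set (Amb m)) := by
  apply IsOpen.inter
  · exact isOpen_ne.preimage (by fun_prop : Continuous fun z : Amb m => z.1 i)
  · exact isOpen_ne.preimage (by fun_prop : Continuous fun z : Amb m => z.2 k)

theorem contDiffOn_coord (i : Fin (m + 1)) (k : Fin 2) :
    ContDiffOn ℝ ∞ (D.coord i k) (ambSource i k) := by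
  rintro z ⟨hi, hk⟩
  apply ContDiffAt.contDiffWithinAt
  have pi1 : ∀ l, ContDiffAt ℝ ∞ (fun z : Amb m => z.1 l) z := fun l => by fun_prop
  have pi2 : ∀ l, ContDiffAt ℝ ∞ (fun z : Amb m => z.2 l) z := fun l => by fun_prop
  have hp : phase (z.2 k) ≠ 0 := by
    intro h; have := norm_phase hk; simp [h] at this
  have q1 : ContDiffAt ℝ ∞ (fun z : Amb m => phase (z.1 i)) z :=
    ContDiffAt.comp (g := phase) z (contDiffAt_phase hi) (pi1 i)
  have q2 : ContDiffAt ℝ ∞ (fun z : Amb m => phase (z.2 k)) z :=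
    ContDiffAt.comp (g := phase) z (contDiffAt_phase hk) (pi2 k)
  refine ContDiffAt.prodMk (contDiffAt_pi.2 fun l => ?_) ?_
  · exact ((ContDiffAt.comp (g := fun y : ℂ => y ^ (D.wt i - D.wt (i.succAbove l))) z
      (contDiffAt_zpow hp _) q2).mul q1).mul (pi1 _)
  · exact q2.mul (pi2 _)

theorem contDiff_normSq : ContDiff ℝ ∞ (fun z : ℂ => ‖z‖ ^ 2) := contDiff_norm_sq ℝ

theorem contDiffAt_sec_fst (i : Fin (m + 1)) (k : Fin 2) {p : Model m}
    (hp : 0 < D.σ / Real.pi - ∑ l, ‖p.1 l‖ ^ 2) :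
    ContDiffAt ℝ ∞ (fun p => (D.sec i k p).1) p := by
  refine contDiffAt_pi.2 fun l => ?_
  refine Fin.succAboveCases i ?_ (fun j => ?_) l
  · simp only [sec_fst_same]
    refine Complex.ofRealCLM.contDiff.contDiffAt.comp p (ContDiffAt.sqrt ?_ hp.ne')
    refine ContDiffAt.sub contDiffAt_const (ContDiffAt.sum fun l _ => ?_)
    exact contDiff_normSq.contDiffAt.comp p (by fun_prop : ContDiffAt ℝ ∞ (fun p : Model m => p.1 l) p)
  · simp only [sec_fst_succAbove]
    fun_prop

theorem contDiffAt_sec (i : Fin (m + 1)) (k : Fin 2) {p : Model m}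
    (hp : p ∈ D.chartTarget i k) : ContDiffAt ℝ ∞ (D.sec i k) p := by
  have h1 := D.contDiffAt_sec_fst i k hp.1
  refine ContDiffAt.prodMk h1 (contDiffAt_pi.2 fun l => ?_)
  refine Fin.succAboveCases k ?_ (fun j => ?_) l
  · change ContDiffAt ℝ ∞ (fun p => (D.sec i k p).2 k) p
    simp only [sec_snd_same]
    refine Complex.ofRealCLM.contDiff.contDiffAt.comp p (ContDiffAt.sqrt ?_ hp.2.ne')
    refine (contDiffAt_const.add (ContDiffAt.sum fun l _ => contDiffAt_const.mul ?_)).sub ?_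
    · exact contDiff_normSq.contDiffAt.comp p (contDiffAt_pi.1 h1 l)
    · exact contDiff_normSq.contDiffAt.comp p contDiffAt_snd
  · change ContDiffAt ℝ ∞ (fun p => (D.sec i k p).2 (k.succAbove j)) p
    simp only [sec_snd_succAbove]
    exact contDiffAt_snd

theorem isOpen_chartTarget (i : Fin (m + 1)) (k : Fin 2) : IsOpen (D.chartTarget i k) := by
  have c1 : Continuous (fun p : Model m => (D.sec i k p).1) := by
    refine continuous_pi fun l => ?_
    refine Fin.succAboveCases i ?_ (fun j => ?_) l
    · simp only [sec_fst_same]; fun_prop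
    · simp only [sec_fst_succAbove]; fun_prop
  have c2 : Continuous fun p : Model m => D.σ / Real.pi - ∑ l, ‖p.1 l‖ ^ 2 := by fun_prop
  have c3 : Continuous fun p : Model m => D.τ / Real.pi +
      ∑ l, (D.wt l : ℝ) * ‖(D.sec i k p).1 l‖ ^ 2 - ‖p.2‖ ^ 2 := by fun_prop
  exact (isOpen_lt continuous_const c2).inter (isOpen_lt continuous_const c3)

/-- The domain `{z_i ≠ 0, z_k ≠ 0}` of a chart of `M_Δ`. -/
def chartSource (i : Fin (m + 1)) (k : Fin 2) : Set D.Toric :=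
  {x | ∃ z : D.Level, D.proj z = x ∧ z.1 ∈ ambSource i k}

theorem gaugeAct_mem_ambSource {i : Fin (m + 1)} {k : Fin 2} {z : Amb m} (lam ε : Circle)
    (h : z ∈ ambSource i k) : D.gaugeAct lam ε z ∈ ambSource i k :=
  ⟨mul_ne_zero (mul_ne_zero (Circle.coe_ne_zero _) (zpow_ne_zero _ (Circle.coe_ne_zero _))) h.1,
    mul_ne_zero (Circle.coe_ne_zero _) h.2⟩

theorem proj_eq_iff (z z' : D.Level) :
    D.proj z = D.proj z' ↔ ∃ lam ε : Circle, z'.1 = D.gaugeAct lam ε z.1 :=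
  Quotient.eq (r := D.orbitSetoid)

theorem proj_surjective : Function.Surjective D.proj := Quotient.mk_surjective

theorem proj_mem_chartSource (i : Fin (m + 1)) (k : Fin 2) (z : D.Level) :
    D.proj z ∈ D.chartSource i k ↔ z.1 ∈ ambSource i k := by
  constructor
  · rintro ⟨z', h, h'⟩
    obtain ⟨lam, ε, e⟩ := (D.proj_eq_iff _ _).1 h
    rw [e]
    exact D.gaugeAct_mem_ambSource lam ε h'
  · exact fun h => ⟨z, rfl, h⟩

theorem isOpen_chartSource (i : Fin (m + 1)) (k : Fin 2) : IsOpen (D.chartSource i k) := by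
  rw [← D.isQuotientMap_proj.isOpen_preimage]
  convert (isOpen_ambSource i k).preimage (continuous_subtype_val (p := (· ∈ D.Level))) using 1
  ext z
  exact D.proj_mem_chartSource i k z

/-- The chart map, `[z] ↦ coord z`. -/
def chartFun (i : Fin (m + 1)) (k : Fin 2) : D.Toric → Model m :=
  Quotient.lift (fun z : D.Level => D.coord i k z.1) (by
    rintro z z' ⟨lam, ε, h⟩
    rw [h, coord_gaugeAct])

theorem chartFun_proj (i : Fin (m + 1)) (k : Fin 2) (z : D.Level) :
    D.chartFun i k (D.proj z) = D.coord i k z.1 := rfl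

open Classical in
/-- The inverse of the chart map, `p ↦ [sec p]` (with an arbitrary value off the target). -/
def chartInv (i : Fin (m + 1)) (k : Fin 2) (p : Model m) : D.Toric :=
  if h : p ∈ D.chartTarget i k then D.proj ⟨D.sec i k p, D.sec_mem i k h⟩
  else D.proj ⟨D.sec i k 0, D.sec_mem i k (D.zero_mem i k)⟩

theorem chartInv_eq (i : Fin (m + 1)) (k : Fin 2) {p : Model m} (h : p ∈ D.chartTarget i k) :
    D.chartInv i k p = D.proj ⟨D.sec i k p, D.sec_mem i k h⟩ := dif_pos h

/-- The chart of `M_Δ` on `{z_i ≠ 0, z_k ≠ 0}`, with values in `ℂ^n`. -/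
def chart (i : Fin (m + 1)) (k : Fin 2) : OpenPartialHomeomorph D.Toric (Model m) where
  toFun := D.chartFun i k
  invFun := D.chartInv i k
  source := D.chartSource i k
  target := D.chartTarget i k
  map_source' := by
    rintro _ ⟨z, rfl, hz⟩
    exact (D.sec_coord i k z.2 hz.1 hz.2).1
  map_target' := by
    intro p hp
    rw [D.chartInv_eq i k hp, proj_mem_chartSource]
    exact D.sec_ne_zero i k hp
  left_inv' := by
    rintro _ ⟨z, rfl, hz⟩
    obtain ⟨h, lam, ε, h'⟩ := D.sec_coord i k z.2 hz.1 hz.2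
    rw [chartFun_proj, D.chartInv_eq i k h]
    exact ((D.proj_eq_iff _ _).2 ⟨lam, ε, h'⟩).symm
  right_inv' := by
    intro p hp
    rw [D.chartInv_eq i k hp, chartFun_proj]
    exact D.coord_sec i k hp
  open_source := D.isOpen_chartSource i k
  open_target := D.isOpen_chartTarget i k
  continuousOn_toFun := by
    rw [D.isQuotientMap_proj.continuousOn_isOpen_iff (D.isOpen_chartSource i k)]
    exact (D.contDiffOn_coord i k).continuousOn.comp continuous_subtype_val.continuousOn
      fun z hz => (D.proj_mem_chartSource i k z).1 hz
  continuousOn_invFun := by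
    rw [continuousOn_iff_continuous_domRestrict]
    have : Continuous fun p : D.chartTarget i k =>
        D.proj ⟨D.sec i k p.1, D.sec_mem i k p.2⟩ := by
      refine D.isQuotientMap_proj.continuous.comp (Continuous.subtype_mk ?_ _)
      refine continuous_iff_continuousAt.2 fun p => ?_
      exact (D.contDiffAt_sec i k p.2).continuousAt.comp continuous_subtype_val.continuousAt
    convert this using 2 with p
    exact D.chartInv_eq i k p.2

theorem exists_mem_source (x : D.Toric) :
    ∃ ik : Fin (m + 1) × Fin 2, x ∈ (D.chart ik.1 ik.2).source := by
  obtain ⟨z, rfl⟩ := D.proj_surjective x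
  have hσ : 0 < D.σ / Real.pi := div_pos D.σ_pos Real.pi_pos
  obtain ⟨h1, h2⟩ := z.2
  have hi : ∃ i, z.1.1 i ≠ 0 := by
    by_contra! h
    simp [h] at h1
    exact hσ.ne h1
  have hk : ∃ k, z.1.2 k ≠ 0 := by
    by_contra! h
    obtain ⟨i, hi⟩ := hi
    have : 0 < ∑ l, (D.τ + D.wt l * D.σ) * ‖z.1.1 l‖ ^ 2 :=
      Finset.sum_pos' (fun l _ => mul_nonneg (D.wt_pos l).le (sq_nonneg _))
        ⟨i, Finset.mem_univ _, mul_pos (D.wt_pos i) (pow_pos (norm_pos_iff.2 hi) 2)⟩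
    have e : ∑ l, (D.τ + D.wt l * D.σ) * ‖z.1.1 l‖ ^ 2 =
        D.τ * ∑ l, ‖z.1.1 l‖ ^ 2 + D.σ * ∑ l, (D.wt l : ℝ) * ‖z.1.1 l‖ ^ 2 := by
      rw [Finset.mul_sum, Finset.mul_sum, ← Finset.sum_add_distrib]
      exact Finset.sum_congr rfl fun l _ => by ring
    rw [e, h1] at this
    simp [h] at h2
    have h3 : ∑ l, (D.wt l : ℝ) * ‖z.1.1 l‖ ^ 2 = -(D.τ / Real.pi) := by linarith
    rw [h3] at this
    have h4 : D.τ * (D.σ / Real.pi) + D.σ * -(D.τ / Real.pi) = 0 := by ring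
    linarith
  obtain ⟨i, hi⟩ := hi
  obtain ⟨k, hk⟩ := hk
  exact ⟨(i, k), (D.proj_mem_chartSource i k z).2 ⟨hi, hk⟩⟩

/-- The index of the preferred chart at `x`. -/
def chartIndex (x : D.Toric) : Fin (m + 1) × Fin 2 := (D.exists_mem_source x).choose

instance : ChartedSpace (Model m) D.Toric where
  atlas := {e | ∃ i k, e = D.chart i k}
  chartAt x := D.chart (D.chartIndex x).1 (D.chartIndex x).2
  mem_chart_source x := (D.exists_mem_source x).choose_spec
  chart_mem_atlas _ := ⟨_, _, rfl⟩

instance : IsManifold 𝓘(ℝ, Model m) ∞ D.Toric := by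
  apply isManifold_of_contDiffOn
  rintro _ _ ⟨i, k, rfl⟩ ⟨i', k', rfl⟩
  simp only [modelWithCornersSelf_coe, modelWithCornersSelf_coe_symm, Function.id_comp,
    Function.comp_id, Set.preimage_id, Set.range_id, Set.inter_univ]
  intro p hp
  have hp' : p ∈ D.chartTarget i k := hp.1
  have hs : D.sec i k p ∈ ambSource i' k' := by
    have h : D.chartInv i k p ∈ D.chartSource i' k' := hp.2
    rwa [D.chartInv_eq i k hp', proj_mem_chartSource] at h
  have hc : ContDiffAt ℝ ∞ (fun p => D.coord i' k' (D.sec i k p)) p :=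
    ((D.contDiffOn_coord i' k').contDiffAt ((isOpen_ambSource i' k').mem_nhds hs)).comp p
      (D.contDiffAt_sec i k hp')
  refine (hc.congr_of_eventuallyEq ?_).contDiffWithinAt
  filter_upwards [(D.isOpen_chartTarget i k).mem_nhds hp'] with q hq
  change D.chartFun i' k' (D.chartInv i k q) = _
  rw [D.chartInv_eq i k hq, chartFun_proj]

/-- The reduced symplectic form of `M_Δ`, characterized by `π^* ω = ι^* ω₀`, where `π` is the
projection of the level set onto `M_Δ`, `ι` is its inclusion in `ℂ^{n+2}`, and `ω₀` is the standard
symplectic form: it is computed by pulling back `ω₀` by a smooth local section of `π`, here the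
one belonging to the preferred chart at `x`, in which the tangent space at `x` is the model
space. -/
def symp (x : D.Toric) : LinearMap.BilinForm ℝ (TangentSpace 𝓘(ℝ, Model m) x) :=
  let s : Model m →ₗ[ℝ] Amb m :=
    (fderiv ℝ (D.sec (D.chartIndex x).1 (D.chartIndex x).2) (chartAt (Model m) x x)).toLinearMap
  (stdForm m).comp s s

/-- The torus action `(t_1, …, t_n) · [z] = [t_1 z_1, …, t_n z_n, z_{n+1}, z_{n+2}]`, on the
ambient space. -/
def torusAmb (t : Fin (m + 1) → Circle) (z : Amb m) : Amb m :=
  (Fin.snoc (α := fun _ => ℂ) (fun j : Fin m => (t j.castSucc : ℂ) * z.1 j.castSucc)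
      (z.1 (Fin.last m)),
    ![(t (Fin.last m) : ℂ) * z.2 0, z.2 1])

theorem torusAmb_mem (t : Fin (m + 1) → Circle) {z : Amb m} (hz : z ∈ D.Level) :
    torusAmb t z ∈ D.Level := by
  obtain ⟨h1, h2⟩ := hz
  constructor
  · rw [← h1]
    simp [Fin.sum_univ_castSucc, torusAmb, Circle.norm_coe]
  · rw [← h2]
    simp [Fin.sum_univ_castSucc, torusAmb, Circle.norm_coe]

theorem torusAmb_gaugeAct (t : Fin (m + 1) → Circle) (lam ε : Circle) (z : Amb m) :
    torusAmb t (D.gaugeAct lam ε z) = D.gaugeAct lam ε (torusAmb t z) := by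
  refine Prod.ext (funext fun l => ?_) (funext fun k => ?_)
  · refine Fin.lastCases ?_ (fun j => ?_) l
    · simp [torusAmb, gaugeAct]
    · simp [torusAmb, gaugeAct]; ring
  · fin_cases k
    · simp [torusAmb, gaugeAct]; ring
    · simp [torusAmb, gaugeAct]

/-- The torus action on `M_Δ`. -/
def torusAct (t : Fin (m + 1) → Circle) : D.Toric → D.Toric :=
  Quotient.map (fun z : D.Level => (⟨torusAmb t z.1, D.torusAmb_mem t z.2⟩ : D.Level)) (by
    rintro z z' ⟨lam, ε, h⟩
    exact ⟨lam, ε, by simp only [h, torusAmb_gaugeAct]⟩)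

/-- The circle action `ψ_b` on `M_Δ` given by the lattice point `b ∈ ℤ^n`. -/
def circleAct (b : Fin (m + 1) → ℤ) (c : Circle) : D.Toric → D.Toric :=
  D.torusAct (fun j => c ^ b j)

/-- The relation `b ≡ b'`: either `b = b'`, or `b'_j = b_j + a_j b_n` for `j < n` and
`b'_n = -b_n`. -/
def LatticeEquiv (b b' : Fin (m + 1) → ℤ) : Prop :=
  b = b' ∨ ((∀ j : Fin m, b' j.castSucc = b j.castSucc + D.a j * b (Fin.last m)) ∧
    b' (Fin.last m) = -b (Fin.last m))

end PolytopeData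

end HamTorus

end

/-!
Write a point of `ℂ^{n+2}` as `(u, w)` with `w = (z_n, z_{n+2}) ∈ ℂ²`. The two coordinates of `w`
have the same weight under the gauge group `U(1)²` and enter the equations of the level set only
through `|z_n|² + |z_{n+2}|²`. Hence `U(2)`, acting on `w`, acts on `M_Δ`, and the circle action
`ψ_b` can be conjugated by the rotations of `ℂ²`. The conjugate by the rotation of angle `θ`
(`frameAmb`, `frameAct`) still has weights `b_1, …, b_{n-1}, 0` on `u`, and has weight `b_n` on the
line of `e_θ = (cos θ, sin θ)` and `0` on the orthogonal complement of that line. For `θ = 0` it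
is `ψ_b` (`frameAct_zero`). For `θ = π/2` it rotates `z_{n+2}` instead of `z_n`, and a gauge
transformation with `ε = c^{-b_n}` shows that it is `ψ_{b'}` with `b'_j = b_j + a_j b_n` and
`b'_n = -b_n` (`frameAct_pi_div_two`). So `θ ∈ [0, π/2]` parametrizes the homotopy.

Three facts make this a homotopy through Hamiltonian circle actions.

* Equivariant smooth families of maps of `ℂ^{n+2}` that preserve the level set induce smooth
  families of maps of `M_Δ` (`contMDiff_of_lift`); so all actions are smooth, jointly in `θ`.
* The action is Hamiltonian (`frameDiffeo_isHamiltonian`), with Hamiltonian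
  `-(∑ b_j |z_j|² + b_n |⟨e_θ, w⟩|²) / 2`. Upstairs this is a computation (`hasDerivAt_hamAmb`,
  `hasDerivAt_frameAmb`). It descends because passing to the normalized representative
  `sec (coord z)` changes velocities only by gauge directions (`hasDerivAt_sec_coord`), and these
  are `ω₀`-orthogonal to the level set (`stdForm_gaugeVec`).
* A family of diffeomorphisms that depends smoothly on parameters in a normed space is continuous
  for the `C^∞` topology (`continuous_smoothTopology`); the circle is reached through the open
  quotient map `Circle.exp`.
-/

noncomputable section

namespace HamTorus

/-! ### Smooth families of diffeomorphisms -/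

section Families

/-- Derivatives in the second variable of a smooth function of two variables depend continuously
on both variables. -/
theorem continuousOn_iteratedFDeriv_partial {P E F : Type*} [NormedAddCommGroup P]
    [NormedSpace ℝ P] [NormedAddCommGroup E] [NormedSpace ℝ E] [NormedAddCommGroup F]
    [NormedSpace ℝ F] {G : P × E → F} {U : Set (P × E)} (hU : IsOpen U)
    (hG : ContDiffOn ℝ ∞ G U) (j : ℕ) :
    ContinuousOn (fun q : P × E => iteratedFDeriv ℝ j (fun y => G (q.1, y)) q.2) U := by
  have key : ∀ q ∈ U, iteratedFDeriv ℝ j (fun y => G (q.1, y)) q.2 =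
      (iteratedFDeriv ℝ j G q).compContinuousLinearMap
        (fun _ => ContinuousLinearMap.inr ℝ P E) := by
    rintro ⟨p, y⟩ hq
    have hV : IsOpen ((fun q : P × E => (p, (0 : E)) + q) ⁻¹' U) :=
      hU.preimage (continuous_const.add continuous_id)
    have hf : ContDiffOn ℝ ∞ (fun q => G ((p, (0 : E)) + q))
        ((fun q : P × E => (p, (0 : E)) + q) ⁻¹' U) :=
      hG.comp (contDiff_const.add contDiff_id).contDiffOn fun _ h => h
    have hW := hV.preimage (ContinuousLinearMap.inr ℝ P E).continuous
    have hy : ContinuousLinearMap.inr ℝ P E y ∈ (fun q : P × E => (p, (0 : E)) + q) ⁻¹' U := by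
      simpa using hq
    have h := (ContinuousLinearMap.inr ℝ P E).iteratedFDerivWithin_comp_right hf
      hV.uniqueDiffOn hW.uniqueDiffOn hy (i := j) (mod_cast le_top)
    rw [iteratedFDerivWithin_of_isOpen j hW hy, iteratedFDerivWithin_of_isOpen j hV hy,
      iteratedFDeriv_comp_add_left] at h
    simpa [Function.comp_def] using h
  refine ContinuousOn.congr ?_ key
  have h1 : ContinuousOn (iteratedFDeriv ℝ j G) U :=
    (hG.continuousOn_iteratedFDerivWithin (m := j) (mod_cast le_top) hU.uniqueDiffOn).congr
      fun q hq => (iteratedFDerivWithin_of_isOpen j hU hq).symm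
  exact (ContinuousMultilinearMap.compContinuousLinearMapL (𝕜 := ℝ) (F := F)
    (fun _ : Fin j => ContinuousLinearMap.inr ℝ P E)).continuous.comp_continuousOn h1

variable {E : Type*} [NormedAddCommGroup E] [NormedSpace ℝ E]
  {M : Type*} [TopologicalSpace M] [ChartedSpace E M]

/-- A family of diffeomorphisms which depends smoothly on a parameter in a normed space is
continuous for the `C^∞` topology: by joint continuity of the derivatives in charts, the condition
that defines a subbasic neighbourhood is open in the parameter and the point together, and the
points range over a compact set. -/
theorem continuous_smoothTopology {P : Type*} [NormedAddCommGroup P] [NormedSpace ℝ P]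
    (Φ : P → (M ≃ₘ⟮𝓘(ℝ, E), 𝓘(ℝ, E)⟯ M))
    (hΦ : ContMDiff (𝓘(ℝ, P).prod 𝓘(ℝ, E)) 𝓘(ℝ, E) ∞ (fun q : P × M => Φ q.1 q.2)) :
    @Continuous _ _ _ smoothTopology Φ := by
  refine continuous_generateFrom_iff.2 ?_
  rintro _ ⟨f, c, c', K, r, ε, hc, hc', hK, hKc, hfK, hε, rfl⟩
  rw [isOpen_iff_mem_nhds]
  intro p₀ hp₀
  have hKE : IsCompact (c '' K) := hK.image_of_continuousOn (c.continuousOn.mono hKc)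
  -- the domain on which the local expression of the family makes sense
  let U : Set (P × E) := {q | q.2 ∈ c.target ∧ Φ q.1 (c.symm q.2) ∈ c'.source}
  have hinner : ContMDiffOn 𝓘(ℝ, P × E) 𝓘(ℝ, E) ∞
      (fun q : P × E => Φ q.1 (c.symm q.2)) (Set.univ ×ˢ c.target) :=
    hΦ.comp_contMDiffOn (contDiff_fst.contMDiff.contMDiffOn.prodMk
      ((contMDiffOn_symm_of_mem_maximalAtlas hc).comp contDiff_snd.contMDiff.contMDiffOn
        fun q hq => hq.2))
  have hU : IsOpen U := by
    have := hinner.continuousOn.isOpen_inter_preimage (isOpen_univ.prod c.open_target)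
      c'.open_source
    convert this using 1
    ext q; simp [U]
  have hG : ContDiffOn ℝ ∞ (fun q : P × E => c' (Φ q.1 (c.symm q.2))) U := by
    rw [← contMDiffOn_iff_contDiffOn]
    exact (contMDiffOn_of_mem_maximalAtlas hc').comp
      (hinner.mono fun q hq => ⟨Set.mem_univ _, hq.1⟩) fun q hq => hq.2
  have hf : ContDiffOn ℝ ∞ (fun y => c' (f (c.symm y)))
      (c.target ∩ c.symm ⁻¹' (f ⁻¹' c'.source)) := by
    rw [← contMDiffOn_iff_contDiffOn]
    exact (contMDiffOn_of_mem_maximalAtlas hc').comp (f.contMDiff.comp_contMDiffOn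
      ((contMDiffOn_symm_of_mem_maximalAtlas hc).mono Set.inter_subset_left)) fun q hq => hq.2
  have hW : IsOpen (c.target ∩ c.symm ⁻¹' (f ⁻¹' c'.source)) :=
    c.isOpen_inter_preimage_symm (c'.open_source.preimage f.contMDiff.continuous)
  have hmem : ∀ p, (∀ y ∈ c '' K, (p, y) ∈ U ∧ ∀ j ∈ Finset.range (r + 1),
      ‖iteratedFDeriv ℝ j (fun y => c' (f (c.symm y))) y -
        iteratedFDeriv ℝ j (fun y => c' (Φ p (c.symm y))) y‖ < ε) →
      Φ p ∈ smoothNhd f c c' K r ε := by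
    intro p h
    refine ⟨fun x hx => ?_, fun j hj y hy => (h y hy).2 j (Finset.mem_range_succ_iff.2 hj)⟩
    have := (h _ ⟨x, hx, rfl⟩).1.2
    rwa [c.left_inv (hKc hx)] at this
  suffices ∀ᶠ p in nhds p₀, ∀ y ∈ c '' K, (p, y) ∈ U ∧ ∀ j ∈ Finset.range (r + 1),
      ‖iteratedFDeriv ℝ j (fun y => c' (f (c.symm y))) y -
        iteratedFDeriv ℝ j (fun y => c' (Φ p (c.symm y))) y‖ < ε from this.mono hmem
  refine hKE.eventually_forall_of_forall_eventually fun y hy => ?_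
  have hyU : (p₀, y) ∈ U := by
    obtain ⟨x, hx, rfl⟩ := hy
    refine ⟨c.map_source (hKc hx), ?_⟩
    rw [c.left_inv (hKc hx)]
    exact hp₀.1 hx
  have hyW : y ∈ c.target ∩ c.symm ⁻¹' (f ⁻¹' c'.source) := by
    obtain ⟨x, hx, rfl⟩ := hy
    refine ⟨c.map_source (hKc hx), ?_⟩
    rw [Set.mem_preimage, c.left_inv (hKc hx)]
    exact hfK hx
  refine Filter.Eventually.and (hU.mem_nhds hyU) ((Finset.eventually_all _).2 fun j hj => ?_)
  have h1 : ContinuousAt (fun q : P × E =>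
      iteratedFDeriv ℝ j (fun y => c' (Φ q.1 (c.symm y))) q.2) (p₀, y) :=
    (continuousOn_iteratedFDeriv_partial hU hG j).continuousAt (hU.mem_nhds hyU)
  have h2 : ContinuousAt (iteratedFDeriv ℝ j (fun y => c' (f (c.symm y)))) y :=
    ((hf.continuousOn_iteratedFDerivWithin (m := j) (mod_cast le_top) hW.uniqueDiffOn).congr
      fun q hq => (iteratedFDerivWithin_of_isOpen j hW hq).symm).continuousAt (hW.mem_nhds hyW)
  have h3 : ContinuousAt (fun q : P × E => ‖iteratedFDeriv ℝ j (fun y => c' (f (c.symm y))) q.2 -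
      iteratedFDeriv ℝ j (fun y => c' (Φ q.1 (c.symm y))) q.2‖) (p₀, y) :=
    ((ContinuousAt.comp (x := (p₀, y)) (f := Prod.snd) h2 continuousAt_snd).sub h1).norm
  exact h3.eventually (gt_mem_nhds (hp₀.2 j (Finset.mem_range_succ_iff.1 hj) y hy))

end Families

/-! ### The action of a circle subgroup of `T × U(2)` -/

section Frame

/-- The unit vector `e_θ = (cos θ, sin θ)` of `ℂ²`. -/
def axis (θ : ℝ) : Fin 2 → ℂ := ![(Real.cos θ : ℂ), (Real.sin θ : ℂ)]

/-- The coefficient `⟨e_θ, w⟩` of `w` along `e_θ`. -/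
def along (θ : ℝ) (w : Fin 2 → ℂ) : ℂ := Real.cos θ * w 0 + Real.sin θ * w 1

theorem along_smul (θ : ℝ) (c : ℂ) (w : Fin 2 → ℂ) :
    along θ (fun k => c * w k) = c * along θ w := by
  simp only [along]; ring

theorem cos_sq_add_sin_sq_coe (θ : ℝ) : (Real.cos θ : ℂ) ^ 2 + (Real.sin θ : ℂ) ^ 2 = 1 := by
  exact_mod_cast Real.cos_sq_add_sin_sq θ

variable {m : ℕ}

/-- The exponents `b_1, …, b_{n-1}, 0` of the circle action on `z_1, …, z_{n-1}, z_{n+1}`. -/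
def expo (b : Fin (m + 1) → ℤ) : Fin (m + 1) → ℤ :=
  Fin.snoc (α := fun _ => ℤ) (fun j : Fin m => b j.castSucc) 0

/-- The linear circle action on `ℂ^{n+2}` which has weights `b_1, …, b_{n-1}, 0` on `u`, and on
`w ∈ ℂ²` has weight `b_n` on the line spanned by `e_θ` and `0` on its orthogonal complement. It is
the action of `b` conjugated by the rotation of `ℂ²` by the angle `θ`. -/
def frameAmb (b : Fin (m + 1) → ℤ) (θ : ℝ) (c : Circle) (z : Amb m) : Amb m :=
  (fun l => (c : ℂ) ^ expo b l * z.1 l,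
    fun k => z.2 k + ((c : ℂ) ^ b (Fin.last m) - 1) * along θ z.2 * axis θ k)

theorem along_frameAmb (b : Fin (m + 1) → ℤ) (θ : ℝ) (c : Circle) (z : Amb m) :
    along θ (frameAmb b θ c z).2 = (c : ℂ) ^ b (Fin.last m) * along θ z.2 := by
  simp only [along, frameAmb, axis, Matrix.cons_val_zero, Matrix.cons_val_one]
  linear_combination ((c : ℂ) ^ b (Fin.last m) - 1) *
    (Real.cos θ * z.2 0 + Real.sin θ * z.2 1) * cos_sq_add_sin_sq_coe θ

theorem frameAmb_one (b : Fin (m + 1) → ℤ) (θ : ℝ) (z : Amb m) : frameAmb b θ 1 z = z := by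
  simp [frameAmb]

theorem frameAmb_mul (b : Fin (m + 1) → ℤ) (θ : ℝ) (c c' : Circle) (z : Amb m) :
    frameAmb b θ (c * c') z = frameAmb b θ c (frameAmb b θ c' z) := by
  refine Prod.ext (funext fun l => ?_) (funext fun k => ?_)
  · simp only [frameAmb, Circle.coe_mul, mul_zpow]; ring
  · conv_rhs => rw [frameAmb]
    simp only [along_frameAmb]
    simp only [frameAmb, Circle.coe_mul, mul_zpow]; ring

theorem norm_coe_zpow (c : Circle) (d : ℤ) : ‖(c : ℂ) ^ d‖ = 1 := by
  rw [norm_zpow, Circle.norm_coe, one_zpow]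

theorem sum_norm_sq_rotate (θ : ℝ) {ζ : ℂ} (hζ : ‖ζ‖ = 1) (w : Fin 2 → ℂ) :
    ∑ k, ‖w k + (ζ - 1) * along θ w * axis θ k‖ ^ 2 = ∑ k, ‖w k‖ ^ 2 := by
  have h1 : ζ.re * ζ.re + ζ.im * ζ.im = 1 := by
    rw [← Complex.normSq_apply, ← Complex.sq_norm, hζ, one_pow]
  have h2 := Real.cos_sq_add_sin_sq θ
  simp only [Fin.sum_univ_two, axis, along, Matrix.cons_val_zero, Matrix.cons_val_one,
    Complex.sq_norm, Complex.normSq_apply, Complex.add_re, Complex.add_im, Complex.mul_re,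
    Complex.mul_im, Complex.sub_re, Complex.sub_im, Complex.one_re, Complex.one_im,
    Complex.ofReal_re, Complex.ofReal_im]
  linear_combination ((Real.cos θ * (w 0).re + Real.sin θ * (w 1).re) ^ 2 +
    (Real.cos θ * (w 0).im + Real.sin θ * (w 1).im) ^ 2) * h1 +
    ((ζ.re - 1) ^ 2 + ζ.im ^ 2) * ((Real.cos θ * (w 0).re + Real.sin θ * (w 1).re) ^ 2 +
    (Real.cos θ * (w 0).im + Real.sin θ * (w 1).im) ^ 2) * h2

namespace PolytopeData

variable (D : PolytopeData m)

theorem frameAmb_mem (b : Fin (m + 1) → ℤ) (θ : ℝ) (c : Circle) {z : Amb m} (hz : z ∈ D.Level) :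
    frameAmb b θ c z ∈ D.Level := by
  obtain ⟨h1, h2⟩ := hz
  constructor
  · rw [← h1]
    simp [frameAmb, Circle.norm_coe]
  · rw [← h2]
    simp only [frameAmb, norm_mul, norm_coe_zpow, one_mul]
    rw [sum_norm_sq_rotate θ (norm_coe_zpow c _)]

theorem frameAmb_gaugeAct (b : Fin (m + 1) → ℤ) (θ : ℝ) (c lam ε : Circle) (z : Amb m) :
    frameAmb b θ c (D.gaugeAct lam ε z) = D.gaugeAct lam ε (frameAmb b θ c z) := by
  refine Prod.ext (funext fun l => ?_) (funext fun k => ?_)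
  · simp only [frameAmb, gaugeAct]; ring
  · simp only [frameAmb, gaugeAct, along_smul]; ring

/-- The circle action on `M_Δ` induced by `frameAmb`. -/
def frameAct (b : Fin (m + 1) → ℤ) (θ : ℝ) (c : Circle) : D.Toric → D.Toric :=
  Quotient.map (fun z : D.Level => (⟨frameAmb b θ c z.1, D.frameAmb_mem b θ c z.2⟩ : D.Level)) (by
    rintro z z' ⟨lam, ε, h⟩
    exact ⟨lam, ε, by simp only [h, frameAmb_gaugeAct]⟩)

theorem frameAct_proj (b : Fin (m + 1) → ℤ) (θ : ℝ) (c : Circle) (z : D.Level) :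
    D.frameAct b θ c (D.proj z) = D.proj ⟨frameAmb b θ c z.1, D.frameAmb_mem b θ c z.2⟩ := rfl

theorem frameAct_one (b : Fin (m + 1) → ℤ) (θ : ℝ) (x : D.Toric) : D.frameAct b θ 1 x = x := by
  obtain ⟨z, rfl⟩ := D.proj_surjective x
  rw [frameAct_proj]
  exact congrArg D.proj (Subtype.ext (frameAmb_one b θ z.1))

theorem frameAct_mul (b : Fin (m + 1) → ℤ) (θ : ℝ) (c c' : Circle) (x : D.Toric) :
    D.frameAct b θ (c * c') x = D.frameAct b θ c (D.frameAct b θ c' x) := by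
  obtain ⟨z, rfl⟩ := D.proj_surjective x
  simp only [frameAct_proj]
  exact congrArg D.proj (Subtype.ext (frameAmb_mul b θ c c' z.1))

theorem frameAct_zero (b : Fin (m + 1) → ℤ) (c : Circle) :
    D.frameAct b 0 c = D.circleAct b c := by
  funext x
  obtain ⟨z, rfl⟩ := D.proj_surjective x
  refine congrArg D.proj (Subtype.ext (Prod.ext (funext fun l => ?_) (funext fun k => ?_)))
  · refine Fin.lastCases ?_ (fun j => ?_) l <;> simp [frameAmb, expo, torusAmb]
  · fin_cases k <;> simp [frameAmb, torusAmb, along, axis]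
    ring

/-- The action rotated by `π/2` has weights `(0, b_n)` on `(z_n, z_{n+2})`; the gauge transformation
with `ε = c^{-b_n}` turns these into `(-b_n, 0)` and adds `a_j b_n` to the weight of `z_j`. -/
theorem frameAct_pi_div_two {b b' : Fin (m + 1) → ℤ}
    (h : ∀ j : Fin m, b' j.castSucc = b j.castSucc + D.a j * b (Fin.last m))
    (h' : b' (Fin.last m) = -b (Fin.last m)) (c : Circle) :
    D.frameAct b (Real.pi / 2) c = D.circleAct b' c := by
  funext x
  obtain ⟨z, rfl⟩ := D.proj_surjective x
  have hc : (c : ℂ) ≠ 0 := Circle.coe_ne_zero c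
  refine (D.proj_eq_iff _ _).2 ⟨1, c ^ (-b (Fin.last m)),
    Prod.ext (funext fun l => ?_) (funext fun k => ?_)⟩
  · refine Fin.lastCases ?_ (fun j => ?_) l
    · simp [frameAmb, expo, torusAmb, gaugeAct, wt]
    · simp only [torusAmb, gaugeAct, frameAmb, expo, wt, Fin.snoc_castSucc, h, Circle.coe_one,
        Circle.coe_zpow, one_mul]
      rw [← zpow_mul, ← mul_assoc, ← zpow_add₀ hc]
      congr 2
      ring
  · fin_cases k
    · simp [frameAmb, torusAmb, gaugeAct, along, axis, h']
    · simp [frameAmb, torusAmb, gaugeAct, along, axis]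
      field_simp
      ring

/-! ### Smoothness of induced maps -/

/-- The map of `M_Δ` induced by an equivariant self-map of the level set is smooth, with
parameters, if it extends to a smooth map of the ambient space: locally it is
`chart⁻¹ ∘ coord ∘ F ∘ sec ∘ chart`. -/
theorem contMDiff_of_lift {EN HN N : Type*} [NormedAddCommGroup EN] [NormedSpace ℝ EN]
    [TopologicalSpace HN] [TopologicalSpace N] [ChartedSpace HN N]
    {I : ModelWithCorners ℝ EN HN} {F : N → Amb m → Amb m} {f : N → D.Toric → D.Toric}
    (hF : ContMDiff (I.prod 𝓘(ℝ, Amb m)) 𝓘(ℝ, Amb m) ∞ (fun q : N × Amb m => F q.1 q.2))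
    (hmem : ∀ n, ∀ z ∈ D.Level, F n z ∈ D.Level)
    (hf : ∀ n (z : D.Level), f n (D.proj z) = D.proj ⟨F n z.1, hmem n z.1 z.2⟩) :
    ContMDiff (I.prod 𝓘(ℝ, Model m)) 𝓘(ℝ, Model m) ∞ (fun q : N × D.Toric => f q.1 q.2) := by
  rintro ⟨n₀, x₀⟩
  obtain ⟨⟨i, k⟩, hx⟩ := D.exists_mem_source x₀
  obtain ⟨⟨i', k'⟩, hx'⟩ := D.exists_mem_source (f n₀ x₀)
  have hat : ∀ i k, D.chart i k ∈ IsManifold.maximalAtlas 𝓘(ℝ, Model m) ∞ D.Toric := fun i k =>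
    IsManifold.subset_maximalAtlas ⟨i, k, rfl⟩
  have hfx : ∀ n, ∀ x (h : x ∈ D.chartSource i k), f n x =
      D.proj ⟨F n (D.sec i k (D.chart i k x)),
        hmem n _ (D.sec_mem i k ((D.chart i k).map_source h))⟩ := by
    intro n x h
    rw [← hf n ⟨_, D.sec_mem i k ((D.chart i k).map_source h)⟩]
    exact congrArg (f n) (((D.chart i k).left_inv h).symm.trans
      (D.chartInv_eq i k ((D.chart i k).map_source h)))
  let S : N × D.Toric → Amb m := fun q => F q.1 (D.sec i k (D.chart i k q.2))
  have hp : D.chart i k x₀ ∈ D.chartTarget i k := (D.chart i k).map_source hx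
  have hS : ContMDiffAt (I.prod 𝓘(ℝ, Model m)) 𝓘(ℝ, Amb m) ∞ S (n₀, x₀) := by
    have h1 : ContMDiffAt (I.prod 𝓘(ℝ, Model m)) 𝓘(ℝ, Model m) ∞
        (fun q : N × D.Toric => D.chart i k q.2) (n₀, x₀) :=
      ((contMDiffOn_of_mem_maximalAtlas (hat i k)).contMDiffAt
        ((D.chart i k).open_source.mem_nhds hx)).comp (n₀, x₀) contMDiffAt_snd
    have h2 : ContMDiffAt (I.prod 𝓘(ℝ, Model m)) 𝓘(ℝ, Amb m) ∞
        (fun q : N × D.Toric => D.sec i k (D.chart i k q.2)) (n₀, x₀) :=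
      ContMDiffAt.comp (n₀, x₀) (g := D.sec i k) (D.contDiffAt_sec i k hp).contMDiffAt h1
    exact ContMDiffAt.comp (n₀, x₀) (g := fun q : N × Amb m => F q.1 q.2) (hF _)
      (contMDiffAt_fst.prodMk h2)
  have hS' : S (n₀, x₀) ∈ ambSource i' k' := by
    have := hx'
    rw [hfx n₀ x₀ hx] at this
    exact (D.proj_mem_chartSource i' k' _).1 this
  have hC : ContMDiffAt (I.prod 𝓘(ℝ, Model m)) 𝓘(ℝ, Model m) ∞
      (fun q => D.coord i' k' (S q)) (n₀, x₀) :=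
    ContMDiffAt.comp (n₀, x₀) (g := D.coord i' k') ((D.contDiffOn_coord i' k').contDiffAt
      ((isOpen_ambSource i' k').mem_nhds hS')).contMDiffAt hS
  have hL : S (n₀, x₀) ∈ D.Level := hmem _ _ (D.sec_mem i k hp)
  have hT : ContMDiffAt (I.prod 𝓘(ℝ, Model m)) 𝓘(ℝ, Model m) ∞
      (fun q => (D.chart i' k').symm (D.coord i' k' (S q))) (n₀, x₀) :=
    ContMDiffAt.comp (n₀, x₀) (g := (D.chart i' k').symm)
      ((contMDiffOn_symm_of_mem_maximalAtlas (hat i' k')).contMDiffAt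
        ((D.isOpen_chartTarget i' k').mem_nhds (D.sec_coord i' k' hL hS'.1 hS'.2).1)) hC
  refine hT.congr_of_eventuallyEq ?_
  filter_upwards [(continuous_snd.isOpen_preimage _ (D.isOpen_chartSource i k)).mem_nhds hx,
    hS.continuousAt.preimage_mem_nhds ((isOpen_ambSource i' k').mem_nhds hS')] with q hq hq'
  rw [hfx q.1 q.2 hq]
  exact ((D.chart i' k').left_inv ((D.proj_mem_chartSource i' k'
    ⟨S q, hmem q.1 _ (D.sec_mem i k ((D.chart i k).map_source hq))⟩).2 hq')).symm

/-- A function on `M_Δ` is smooth if it is induced by a smooth function on the ambient space. -/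
theorem contMDiff_of_lift_real {F : Amb m → ℝ} {f : D.Toric → ℝ} (hF : ContDiff ℝ ∞ F)
    (hf : ∀ z : D.Level, f (D.proj z) = F z.1) :
    ContMDiff 𝓘(ℝ, Model m) 𝓘(ℝ, ℝ) ∞ f := by
  intro x₀
  obtain ⟨⟨i, k⟩, hx⟩ := D.exists_mem_source x₀
  have hat : D.chart i k ∈ IsManifold.maximalAtlas 𝓘(ℝ, Model m) ∞ D.Toric :=
    IsManifold.subset_maximalAtlas ⟨i, k, rfl⟩
  have h1 : ContMDiffAt 𝓘(ℝ, Model m) 𝓘(ℝ, Model m) ∞ (D.chart i k) x₀ :=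
    (contMDiffOn_of_mem_maximalAtlas hat).contMDiffAt ((D.chart i k).open_source.mem_nhds hx)
  have h2 : ContMDiffAt 𝓘(ℝ, Model m) 𝓘(ℝ, ℝ) ∞ (fun x => F (D.sec i k (D.chart i k x))) x₀ :=
    ContMDiffAt.comp x₀ (g := fun p => F (D.sec i k p)) (hF.contDiffAt.comp _
      (D.contDiffAt_sec i k ((D.chart i k).map_source hx))).contMDiffAt h1
  refine h2.congr_of_eventuallyEq ?_
  filter_upwards [(D.isOpen_chartSource i k).mem_nhds hx] with x hx
  have hp := (D.chart i k).map_source hx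
  rw [← hf ⟨_, D.sec_mem i k hp⟩]
  exact congrArg f (((D.chart i k).left_inv hx).symm.trans (D.chartInv_eq i k hp))

theorem contMDiff_frameAmb (b : Fin (m + 1) → ℤ) :
    ContMDiff ((𝓘(ℝ, ℝ).prod (𝓡 1)).prod 𝓘(ℝ, Amb m)) 𝓘(ℝ, Amb m) ∞
      (fun q : (ℝ × Circle) × Amb m => frameAmb b q.1.1 q.1.2 q.2) := by
  have hz : ∀ d : ℤ, ContDiffOn ℝ ∞ (fun z : ℂ => z ^ d) {0}ᶜ := fun d z hz =>
    (contDiffAt_zpow hz d).contDiffWithinAt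
  have hext : ContDiffOn ℝ ∞ (fun q : (ℝ × ℂ) × Amb m =>
      ((fun l => q.1.2 ^ expo b l * q.2.1 l, fun k => q.2.2 k +
        (q.1.2 ^ b (Fin.last m) - 1) * along q.1.1 q.2.2 * axis q.1.1 k) : Amb m))
      {q | q.1.2 ≠ 0} := by
    have hp : ∀ d : ℤ, ContDiffOn ℝ ∞ (fun q : (ℝ × ℂ) × Amb m => q.1.2 ^ d) {q | q.1.2 ≠ 0} :=
      fun d => (hz d).comp (by fun_prop : ContDiff ℝ ∞ fun q : (ℝ × ℂ) × Amb m => q.1.2).contDiffOn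
        fun q hq => hq
    have hcos : ContDiff ℝ ∞ (fun q : (ℝ × ℂ) × Amb m => (Real.cos q.1.1 : ℂ)) :=
      Complex.ofRealCLM.contDiff.comp (Real.contDiff_cos.comp (by fun_prop))
    have hsin : ContDiff ℝ ∞ (fun q : (ℝ × ℂ) × Amb m => (Real.sin q.1.1 : ℂ)) :=
      Complex.ofRealCLM.contDiff.comp (Real.contDiff_sin.comp (by fun_prop))
    have hw : ∀ k, ContDiff ℝ ∞ (fun q : (ℝ × ℂ) × Amb m => q.2.2 k) := fun k => by fun_prop
    have hal : ContDiff ℝ ∞ (fun q : (ℝ × ℂ) × Amb m => along q.1.1 q.2.2) :=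
      (hcos.mul (hw 0)).add (hsin.mul (hw 1))
    have hax : ∀ k, ContDiff ℝ ∞ (fun q : (ℝ × ℂ) × Amb m => axis q.1.1 k) := fun k => by
      fin_cases k
      · exact hcos
      · exact hsin
    refine ContDiffOn.prodMk (contDiffOn_pi.2 fun l => (hp _).mul ?_)
      (contDiffOn_pi.2 fun k => (hw k).contDiffOn.add
        ((((hp _).sub contDiffOn_const).mul hal.contDiffOn).mul (hax k).contDiffOn))
    exact (by fun_prop : ContDiff ℝ ∞ fun q : (ℝ × ℂ) × Amb m => q.2.1 l).contDiffOn
  have hin : ContMDiff ((𝓘(ℝ, ℝ).prod (𝓡 1)).prod 𝓘(ℝ, Amb m)) 𝓘(ℝ, (ℝ × ℂ) × Amb m) ∞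
      (fun q : (ℝ × Circle) × Amb m => ((q.1.1, (q.1.2 : ℂ)), q.2)) := by
    have hcoe : ContMDiff (𝓡 1) 𝓘(ℝ, ℂ) ∞ (fun c : Circle => (c : ℂ)) :=
      haveI := finrank_real_complex_fact'
      contMDiff_coe_sphere (E := ℂ) (n := 1)
    exact ((contMDiff_fst.comp contMDiff_fst).prodMk_space
      (hcoe.comp (contMDiff_snd.comp contMDiff_fst))).prodMk_space contMDiff_snd
  exact hext.contMDiffOn.comp_contMDiff hin fun q => Circle.coe_ne_zero q.1.2

theorem contMDiff_frameAct (b : Fin (m + 1) → ℤ) :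
    ContMDiff ((𝓘(ℝ, ℝ).prod (𝓡 1)).prod 𝓘(ℝ, Model m)) 𝓘(ℝ, Model m) ∞
      (fun q : (ℝ × Circle) × D.Toric => D.frameAct b q.1.1 q.1.2 q.2) :=
  D.contMDiff_of_lift (f := fun n : ℝ × Circle => D.frameAct b n.1 n.2)
    (contMDiff_frameAmb b) (fun n _ => D.frameAmb_mem b n.1 n.2)
    (fun n => D.frameAct_proj b n.1 n.2)

/-- The diffeomorphism of `M_Δ` by which `c` acts. -/
def frameDiffeo (b : Fin (m + 1) → ℤ) (θ : ℝ) (c : Circle) :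
    D.Toric ≃ₘ⟮𝓘(ℝ, Model m), 𝓘(ℝ, Model m)⟯ D.Toric where
  toFun := D.frameAct b θ c
  invFun := D.frameAct b θ c⁻¹
  left_inv x := by rw [← frameAct_mul, inv_mul_cancel, frameAct_one]
  right_inv x := by rw [← frameAct_mul, mul_inv_cancel, frameAct_one]
  contMDiff_toFun := (D.contMDiff_frameAct b).comp
    ((contMDiff_const (c := (θ, c))).prodMk contMDiff_id)
  contMDiff_invFun := (D.contMDiff_frameAct b).comp
    ((contMDiff_const (c := (θ, c⁻¹))).prodMk contMDiff_id)

theorem frameDiffeo_apply (b : Fin (m + 1) → ℤ) (θ : ℝ) (c : Circle) (x : D.Toric) :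
    D.frameDiffeo b θ c x = D.frameAct b θ c x := rfl

end PolytopeData

end Frame

/-! ### The Hamiltonian of the action -/

section Hamiltonian

theorem hasDerivAt_norm_sq {q : ℝ → ℂ} {q' : ℂ} {t : ℝ} (h : HasDerivAt q q' t) :
    HasDerivAt (fun s => ‖q s‖ ^ 2) (2 * (conj (q t) * q').re) t := by
  have := h.norm_sq
  rwa [Complex.inner, mul_comm q'] at this

/-- The velocity of a curve of unit complex numbers is imaginary where the curve passes through
`1`. -/
theorem exists_eq_I_mul_of_norm_eq_one {g : ℝ → ℂ} {g' : ℂ} {t : ℝ} (hg : HasDerivAt g g' t)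
    (h1 : g t = 1) (hn : ∀ᶠ s in nhds t, ‖g s‖ = 1) : ∃ r : ℝ, g' = Complex.I * r := by
  have h := (hasDerivAt_norm_sq hg).unique ((hasDerivAt_const t (1 : ℝ)).congr_of_eventuallyEq
    (hn.mono fun s hs => by simp [hs]))
  refine ⟨g'.im, Complex.ext ?_ ?_⟩
  · simpa [h1] using h
  · simp

section Charts

variable {E : Type*} [NormedAddCommGroup E] [NormedSpace ℝ E]
  {M : Type*} [TopologicalSpace M] [ChartedSpace E M]

/-- The velocity of a curve, read in the preferred chart at the point of the curve. -/
theorem hasDerivAt_chartAt_curve {f : ℝ → M} {t : ℝ}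
    (hf : MDifferentiableAt 𝓘(ℝ, ℝ) 𝓘(ℝ, E) f t) {X : E}
    (hX : X = mfderiv 𝓘(ℝ, ℝ) 𝓘(ℝ, E) f t (1 : ℝ)) :
    HasDerivAt (fun s => chartAt E (f t) (f s)) X t := by
  have h := hf.hasMFDerivAt.2
  simp only [writtenInExtChartAt, mfld_simps] at h
  have h' : HasFDerivAt (fun s => chartAt E (f t) (f s))
    (show ℝ →L[ℝ] E from mfderiv 𝓘(ℝ, ℝ) 𝓘(ℝ, E) f t) t := hasFDerivWithinAt_univ.1 h
  rw [hX]
  exact h'.hasDerivAt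

/-- The differential of a function, read in the preferred chart. -/
theorem hasDerivAt_chartAt_line {f : M → ℝ} {x : M}
    (hf : MDifferentiableAt 𝓘(ℝ, E) 𝓘(ℝ, ℝ) f x) (v : E) {d : ℝ}
    (hd : d = mfderiv 𝓘(ℝ, E) 𝓘(ℝ, ℝ) f x v) :
    HasDerivAt (fun s : ℝ => f ((chartAt E x).symm (chartAt E x x + s • v))) d 0 := by
  have h := hf.hasMFDerivAt.2
  simp only [writtenInExtChartAt, mfld_simps] at h
  have h' : HasFDerivAt (fun p => f ((chartAt E x).symm p))
    (show E →L[ℝ] ℝ from mfderiv 𝓘(ℝ, E) 𝓘(ℝ, ℝ) f x) (chartAt E x x) :=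
    hasFDerivWithinAt_univ.1 h
  have h2 : HasDerivAt (fun s : ℝ => chartAt E x x + s • v) v 0 := by
    simpa using ((hasDerivAt_id (0 : ℝ)).smul_const v).const_add (chartAt E x x)
  rw [hd]
  exact h'.comp_hasDerivAt_of_eq 0 h2 (by simp)

end Charts

variable {m : ℕ}

theorem stdForm_apply (x y : Amb m) : stdForm m x y =
    ∑ l, (conj (x.1 l) * y.1 l).im + ∑ k, (conj (x.2 k) * y.2 k).im := rfl

theorem hasDerivAt_fst {γ : ℝ → Amb m} {γ' : Amb m} {t : ℝ} (h : HasDerivAt γ γ' t)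
    (l : Fin (m + 1)) : HasDerivAt (fun s => (γ s).1 l) (γ'.1 l) t :=
  ((ContinuousLinearMap.proj (R := ℝ) (φ := fun _ : Fin (m + 1) => ℂ) l).comp
    (ContinuousLinearMap.fst ℝ (Fin (m + 1) → ℂ) (Fin 2 → ℂ))).hasFDerivAt.comp_hasDerivAt t h

theorem hasDerivAt_snd {γ : ℝ → Amb m} {γ' : Amb m} {t : ℝ} (h : HasDerivAt γ γ' t)
    (k : Fin 2) : HasDerivAt (fun s => (γ s).2 k) (γ'.2 k) t :=
  ((ContinuousLinearMap.proj (R := ℝ) (φ := fun _ : Fin 2 => ℂ) k).comp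
    (ContinuousLinearMap.snd ℝ (Fin (m + 1) → ℂ) (Fin 2 → ℂ))).hasFDerivAt.comp_hasDerivAt t h

theorem hasDerivAt_amb {γ : ℝ → Amb m} {γ' : Amb m} {t : ℝ}
    (h1 : ∀ l, HasDerivAt (fun s => (γ s).1 l) (γ'.1 l) t)
    (h2 : ∀ k, HasDerivAt (fun s => (γ s).2 k) (γ'.2 k) t) : HasDerivAt γ γ' t :=
  (hasDerivAt_pi.2 h1).prodMk (hasDerivAt_pi.2 h2)

/-- The Hamiltonian on `ℂ^{n+2}` of the linear circle action `frameAmb`. -/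
def hamAmb (b : Fin (m + 1) → ℤ) (θ : ℝ) (z : Amb m) : ℝ :=
  -(∑ l, (expo b l : ℝ) * ‖z.1 l‖ ^ 2 + (b (Fin.last m) : ℝ) * ‖along θ z.2‖ ^ 2) / 2

/-- The vector field on `ℂ^{n+2}` which generates the linear circle action `frameAmb`. -/
def genAmb (b : Fin (m + 1) → ℤ) (θ : ℝ) (z : Amb m) : Amb m :=
  (fun l => Complex.I * expo b l * z.1 l,
    fun k => Complex.I * b (Fin.last m) * along θ z.2 * axis θ k)

theorem contDiff_hamAmb (b : Fin (m + 1) → ℤ) (θ : ℝ) : ContDiff ℝ ∞ (hamAmb b θ) := by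
  have h1 : ∀ l, ContDiff ℝ ∞ (fun z : Amb m => ‖z.1 l‖ ^ 2) := fun l =>
    contDiff_norm_sq ℝ |>.comp (by fun_prop : ContDiff ℝ ∞ fun z : Amb m => z.1 l)
  have h2 : ContDiff ℝ ∞ (fun z : Amb m => ‖along θ z.2‖ ^ 2) :=
    contDiff_norm_sq ℝ |>.comp
      (by unfold along; fun_prop : ContDiff ℝ ∞ fun z : Amb m => along θ z.2)
  exact (((ContDiff.sum fun l _ => contDiff_const.mul (h1 l)).add
    (contDiff_const.mul h2)).neg).div_const 2

theorem hasDerivAt_along {w : ℝ → Fin 2 → ℂ} {w' : Fin 2 → ℂ} {t : ℝ} (θ : ℝ)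
    (h : ∀ k, HasDerivAt (fun s => w s k) (w' k) t) :
    HasDerivAt (fun s => along θ (w s)) (along θ w') t :=
  ((h 0).const_mul _).add ((h 1).const_mul _)

theorem hasDerivAt_hamAmb (b : Fin (m + 1) → ℤ) (θ : ℝ) {γ : ℝ → Amb m} {γ' : Amb m} {t : ℝ}
    (h : HasDerivAt γ γ' t) :
    HasDerivAt (fun s => hamAmb b θ (γ s)) (stdForm m (genAmb b θ (γ t)) γ') t := by
  have h1 := fun l => hasDerivAt_norm_sq (hasDerivAt_fst h l)
  have h2 := hasDerivAt_norm_sq (hasDerivAt_along θ (hasDerivAt_snd h))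
  have h3 := (((HasDerivAt.fun_sum (u := Finset.univ) fun l _ =>
    (h1 l).const_mul (expo b l : ℝ)).add (h2.const_mul (b (Fin.last m) : ℝ))).neg).div_const 2
  refine h3.congr_deriv ?_
  rw [stdForm_apply, neg_div, add_div, neg_add, Finset.sum_div, ← Finset.sum_neg_distrib]
  congr 1
  · refine Finset.sum_congr rfl fun l _ => ?_
    simp [genAmb]
    ring
  · simp [genAmb, Fin.sum_univ_two, along, axis]
    ring

/-- The linear circle action is generated by `genAmb`. -/
theorem hasDerivAt_frameAmb (b : Fin (m + 1) → ℤ) (θ α : ℝ) (z : Amb m) (t : ℝ) :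
    HasDerivAt (fun s : ℝ => frameAmb b θ (Circle.exp (α * s)) z)
      (α • genAmb b θ (frameAmb b θ (Circle.exp (α * t)) z)) t := by
  have he : ∀ d : ℤ, HasDerivAt (fun s : ℝ => (Circle.exp (α * s) : ℂ) ^ d)
      (α * (Complex.I * d * (Circle.exp (α * t) : ℂ) ^ d)) t := by
    intro d
    have h1 : HasDerivAt (fun s : ℝ => ((d * α * s : ℝ) : ℂ) * Complex.I)
        (((d * α : ℝ) : ℂ) * Complex.I) t := by
      have := ((hasDerivAt_id t).const_mul (d * α)).ofReal_comp.mul_const Complex.I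
      simpa using this
    have e : ∀ s : ℝ, (Circle.exp (α * s) : ℂ) ^ d =
        Complex.exp (((d * α * s : ℝ) : ℂ) * Complex.I) := by
      intro s
      rw [Circle.coe_exp, ← Complex.exp_int_mul]
      congr 1; push_cast; ring
    simp only [e]
    refine h1.cexp.congr_deriv ?_
    push_cast; ring
  refine hasDerivAt_amb (fun l => ?_) (fun k => ?_)
  · refine ((he _).mul_const (z.1 l)).congr_deriv ?_
    simp [genAmb, frameAmb]
    ring
  · refine ((((he _).sub_const 1).mul_const _).mul_const _ |>.const_add (z.2 k)).congr_deriv ?_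
    simp only [Prod.smul_snd, genAmb, along_frameAmb, Pi.smul_apply, Complex.real_smul]
    ring

namespace PolytopeData

variable (D : PolytopeData m)

/-- The infinitesimal gauge action of `(r₁, r₂) ∈ ℝ² = Lie U(1)²` on `ℂ^{n+2}`. -/
def gaugeVec (r₁ r₂ : ℝ) (z : Amb m) : Amb m :=
  (fun l => Complex.I * (r₁ - r₂ * D.wt l) * z.1 l, fun k => Complex.I * r₂ * z.2 k)

/-- The gauge directions are `ω₀`-orthogonal to the level set, because the two equations of the
level set are given by the moment maps of the gauge action. -/
theorem stdForm_gaugeVec {γ : ℝ → Amb m} {γ' : Amb m} {t : ℝ} (h : HasDerivAt γ γ' t)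
    (hL : ∀ᶠ s in nhds t, γ s ∈ D.Level) (r₁ r₂ : ℝ) :
    stdForm m (D.gaugeVec r₁ r₂ (γ t)) γ' = 0 := by
  have h1 := fun l => hasDerivAt_norm_sq (hasDerivAt_fst h l)
  have h2 := fun k => hasDerivAt_norm_sq (hasDerivAt_snd h k)
  have e1 := (HasDerivAt.fun_sum (u := Finset.univ) fun l _ => h1 l).unique
    ((hasDerivAt_const t (D.σ / Real.pi)).congr_of_eventuallyEq (hL.mono fun s hs => hs.1))
  have e2 := ((HasDerivAt.fun_sum (u := Finset.univ) fun l _ =>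
    (h1 l).const_mul (D.wt l : ℝ)).fun_neg.fun_add
      (HasDerivAt.fun_sum (u := Finset.univ) fun k _ => h2 k)).unique
    ((hasDerivAt_const t (D.τ / Real.pi)).congr_of_eventuallyEq (hL.mono fun s hs => hs.2))
  have e : stdForm m (D.gaugeVec r₁ r₂ (γ t)) γ' =
      -(r₁ / 2) * (∑ l, 2 * (conj ((γ t).1 l) * γ'.1 l).re) -
      (r₂ / 2) * (-∑ l, (D.wt l : ℝ) * (2 * (conj ((γ t).1 l) * γ'.1 l).re) +
        ∑ k, 2 * (conj ((γ t).2 k) * γ'.2 k).re) := by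
    have f1 : ∀ l, (conj ((D.gaugeVec r₁ r₂ (γ t)).1 l) * γ'.1 l).im =
        -(r₁ / 2) * (2 * (conj ((γ t).1 l) * γ'.1 l).re) +
          (r₂ / 2) * ((D.wt l : ℝ) * (2 * (conj ((γ t).1 l) * γ'.1 l).re)) := by
      intro l; simp [gaugeVec]; ring
    have f2 : ∀ k, (conj ((D.gaugeVec r₁ r₂ (γ t)).2 k) * γ'.2 k).im =
        -(r₂ / 2) * (2 * (conj ((γ t).2 k) * γ'.2 k).re) := by
      intro k; simp [gaugeVec]; ring
    rw [stdForm_apply, Finset.sum_congr rfl fun l _ => f1 l, Finset.sum_congr rfl fun k _ => f2 k,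
      Finset.sum_add_distrib]
    simp only [← Finset.mul_sum]
    ring
  rw [e, e1, e2]; ring

/-- The representative `sec (coord z)` of `[z]` is obtained from `z` by the gauge transformation
which makes `z_i` and `z_k` positive. -/
theorem sec_coord_eq (i : Fin (m + 1)) (k : Fin 2) {z : Amb m} (hz : z ∈ D.Level)
    (hs : z ∈ ambSource i k) :
    (∀ l, (D.sec i k (D.coord i k z)).1 l =
      phase (z.1 i) * phase (z.2 k) ^ (D.wt i - D.wt l) * z.1 l) ∧
    ∀ j, (D.sec i k (D.coord i k z)).2 j = phase (z.2 k) * z.2 j := by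
  obtain ⟨-, lam, ε, h⟩ := D.sec_coord i k hz hs.1 hs.2
  obtain ⟨n1, n2⟩ := D.norm_gaugeAct lam ε z
  have a1 : (D.sec i k (D.coord i k z)).1 i = ‖z.1 i‖ := by
    rw [← n1, ← h, sec_fst_same, Complex.norm_real, Real.norm_of_nonneg (Real.sqrt_nonneg _)]
  have a2 : (D.sec i k (D.coord i k z)).2 k = ‖z.2 k‖ := by
    rw [← n2, ← h, sec_snd_same, Complex.norm_real, Real.norm_of_nonneg (Real.sqrt_nonneg _)]
  constructor
  · intro l
    refine Fin.succAboveCases i ?_ (fun j => ?_) l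
    · rw [a1, sub_self, zpow_zero, mul_one, phase_mul_self]
    · rw [sec_fst_succAbove, coord]; ring
  · intro j
    refine Fin.succAboveCases k ?_ (fun j => ?_) j
    · rw [a2, phase_mul_self]
    · rw [sec_snd_succAbove, Subsingleton.elim j 0, coord]

/-- Normalizing a curve in the level set changes its velocity by a gauge direction, at a time when
the curve is already normalized. -/
theorem hasDerivAt_sec_coord (i : Fin (m + 1)) (k : Fin 2) {γ : ℝ → Amb m} {γ' : Amb m} {t : ℝ}
    (h : HasDerivAt γ γ' t) (hL : ∀ s, γ s ∈ D.Level) {p : Model m}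
    (hp : p ∈ D.chartTarget i k) (hγ : γ t = D.sec i k p) :
    ∃ r₁ r₂ : ℝ, HasDerivAt (fun s => D.sec i k (D.coord i k (γ s)))
      (γ' + D.gaugeVec r₁ r₂ (γ t)) t := by
  have hmem : γ t ∈ ambSource i k := hγ ▸ D.sec_ne_zero i k hp
  have hev : ∀ᶠ s in nhds t, γ s ∈ ambSource i k :=
    h.continuousAt.eventually_mem ((isOpen_ambSource i k).mem_nhds hmem)
  have p1 : phase ((γ t).1 i) = 1 := by
    rw [hγ, sec_fst_same]; exact phase_ofReal (Real.sqrt_pos.2 hp.1)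
  have p2 : phase ((γ t).2 k) = 1 := by
    rw [hγ, sec_snd_same]; exact phase_ofReal (Real.sqrt_pos.2 hp.2)
  have d1 := HasFDerivAt.comp_hasDerivAt t
    ((contDiffAt_phase hmem.1).differentiableAt (by simp)).hasFDerivAt (hasDerivAt_fst h i)
  have d2 := HasFDerivAt.comp_hasDerivAt t
    ((contDiffAt_phase hmem.2).differentiableAt (by simp)).hasFDerivAt (hasDerivAt_snd h k)
  obtain ⟨r₁, e1⟩ := exists_eq_I_mul_of_norm_eq_one d1 p1 (hev.mono fun s hs => norm_phase hs.1)
  obtain ⟨r₂, e2⟩ := exists_eq_I_mul_of_norm_eq_one d2 p2 (hev.mono fun s hs => norm_phase hs.2)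
  rw [e1] at d1
  rw [e2] at d2
  have d3 : ∀ d : ℤ, HasDerivAt (fun s => phase ((γ s).2 k) ^ d) (d * (Complex.I * r₂)) t := by
    intro d
    have h1 := HasDerivAt.comp t
      (hasDerivAt_zpow d (phase ((γ t).2 k)) (Or.inl (by simp [p2]))) d2
    exact h1.congr_deriv (by simp [p2])
  refine ⟨r₁ + r₂ * D.wt i, r₂, hasDerivAt_amb (fun l => ?_) (fun j => ?_)⟩
  · refine HasDerivAt.congr_of_eventuallyEq (HasDerivAt.congr_deriv
      ((d1.mul (d3 (D.wt i - D.wt l))).mul (hasDerivAt_fst h l)) ?_)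
      (hev.mono fun s hs => (D.sec_coord_eq i k (hL s) hs).1 l)
    simp [p1, p2, gaugeVec]
    ring
  · refine HasDerivAt.congr_of_eventuallyEq (HasDerivAt.congr_deriv
      (d2.mul (hasDerivAt_snd h j)) ?_)
      (hev.mono fun s hs => (D.sec_coord_eq i k (hL s) hs).2 j)
    simp [p2, gaugeVec]
    ring

/-- The Hamiltonian on `M_Δ` of the circle action `frameAct`. -/
def ham (b : Fin (m + 1) → ℤ) (θ : ℝ) : D.Toric → ℝ :=
  Quotient.lift (fun z : D.Level => hamAmb b θ z.1) (by
    rintro z z' ⟨lam, ε, h⟩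
    rw [h]
    simp only [hamAmb, (D.norm_gaugeAct lam ε z.1).1]
    simp [gaugeAct, along_smul, Circle.norm_coe])

theorem ham_proj (b : Fin (m + 1) → ℤ) (θ : ℝ) (z : D.Level) :
    D.ham b θ (D.proj z) = hamAmb b θ z.1 := rfl

theorem contMDiff_ham (b : Fin (m + 1) → ℤ) (θ : ℝ) :
    ContMDiff 𝓘(ℝ, Model m) 𝓘(ℝ, ℝ) ∞ (D.ham b θ) :=
  D.contMDiff_of_lift_real (contDiff_hamAmb b θ) (D.ham_proj b θ)

theorem hasDerivAt_sec_line (i : Fin (m + 1)) (k : Fin 2) {p : Model m}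
    (hp : p ∈ D.chartTarget i k) (v : Model m) :
    HasDerivAt (fun s : ℝ => D.sec i k (p + s • v)) (fderiv ℝ (D.sec i k) p v) 0 := by
  have h1 : HasDerivAt (fun s : ℝ => p + s • v) v 0 := by
    simpa using ((hasDerivAt_id (0 : ℝ)).smul_const v).const_add p
  have h2 : HasFDerivAt (D.sec i k) (fderiv ℝ (D.sec i k) p) (p + (0 : ℝ) • v) := by
    simpa using ((D.contDiffAt_sec i k hp).differentiableAt (by simp)).hasFDerivAt
  exact h2.comp_hasDerivAt 0 h1

/-- The differential of the Hamiltonian, computed in the preferred chart. -/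
theorem mfderiv_ham (b : Fin (m + 1) → ℤ) (θ : ℝ) (x : D.Toric)
    (v : Model m) :
    let ik := D.chartIndex x
    let p : Model m := chartAt (Model m) x x
    mfderiv 𝓘(ℝ, Model m) 𝓘(ℝ, ℝ) (D.ham b θ) x v =
      stdForm m (genAmb b θ (D.sec ik.1 ik.2 p)) (fderiv ℝ (D.sec ik.1 ik.2) p v) := by
  intro ik p
  have hp : p ∈ D.chartTarget ik.1 ik.2 :=
    (chartAt (Model m) x).map_source (mem_chart_source _ x)
  have h0 : MDifferentiableAt 𝓘(ℝ, Model m) 𝓘(ℝ, ℝ) (D.ham b θ) x :=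
    (D.contMDiff_ham b θ).mdifferentiableAt (by simp)
  have h3 := hasDerivAt_chartAt_line h0 v rfl
  have h4 := hasDerivAt_hamAmb b θ (D.hasDerivAt_sec_line ik.1 ik.2 hp v)
  simp only [zero_smul, add_zero] at h4
  refine h3.unique (h4.congr_of_eventuallyEq ?_)
  have hline : ContinuousAt (fun s : ℝ => p + s • v) 0 := by fun_prop
  have hev : ∀ᶠ s : ℝ in nhds 0, p + s • v ∈ D.chartTarget ik.1 ik.2 :=
    hline.eventually_mem ((D.isOpen_chartTarget ik.1 ik.2).mem_nhds (by simpa using hp))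
  filter_upwards [hev] with s hs
  exact congrArg (D.ham b θ) (D.chartInv_eq ik.1 ik.2 hs)

theorem frameDiffeo_isHamiltonian (b : Fin (m + 1) → ℤ) (θ : ℝ) (c : Circle) :
    IsHamiltonian D.symp (D.frameDiffeo b θ c) := by
  obtain ⟨α, rfl⟩ : ∃ α, Circle.exp α = c := ⟨_, Circle.exp_arg c⟩
  have hexp : ContMDiff 𝓘(ℝ, ℝ) (𝓡 1) ∞ (fun t : ℝ => Circle.exp (α * t)) :=
    contMDiff_circleExp.comp (by fun_prop : ContDiff ℝ ∞ fun t : ℝ => α * t).contMDiff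
  have hΦ : ContMDiff (𝓘(ℝ, ℝ).prod 𝓘(ℝ, Model m)) 𝓘(ℝ, Model m) ∞
      (fun q : ℝ × D.Toric => D.frameAct b θ (Circle.exp (α * q.1)) q.2) :=
    (D.contMDiff_frameAct b).comp
      ((contMDiff_const.prodMk (hexp.comp contMDiff_fst)).prodMk contMDiff_snd)
  refine ⟨fun t => D.frameDiffeo b θ (Circle.exp (α * t)), fun _ x => α * D.ham b θ x, hΦ,
    ?_, fun x => ?_, fun x => ?_, fun t x v => ?_⟩
  · exact contMDiff_const.mul ((D.contMDiff_ham b θ).comp contMDiff_snd)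
  · simp [frameDiffeo_apply, frameAct_one]
  · simp
  change Model m at v
  simp only [frameDiffeo_apply]
  set y := D.frameAct b θ (Circle.exp (α * t)) x with hy
  set i := (D.chartIndex y).1
  set k := (D.chartIndex y).2
  have hys : y ∈ D.chartSource i k := (D.exists_mem_source y).choose_spec
  set p : Model m := D.chartFun i k y
  have hp : p ∈ D.chartTarget i k := (D.chart i k).map_source hys
  have hyp : y = D.proj ⟨D.sec i k p, D.sec_mem i k hp⟩ :=
    ((D.chart i k).left_inv hys).symm.trans (D.chartInv_eq i k hp)
  -- the representative of `x` which the flow carries to the normalized representative of `y`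
  let z : D.Level := ⟨frameAmb b θ (Circle.exp (α * t))⁻¹ (D.sec i k p),
    D.frameAmb_mem b θ _ (D.sec_mem i k hp)⟩
  have hzx : D.proj z = x := by
    rw [← D.frameAct_proj b θ _ ⟨D.sec i k p, D.sec_mem i k hp⟩, ← hyp, hy, ← frameAct_mul,
      inv_mul_cancel, frameAct_one]
  let γ : ℝ → Amb m := fun s => frameAmb b θ (Circle.exp (α * s)) z.1
  have hγL : ∀ s, γ s ∈ D.Level := fun s => D.frameAmb_mem b θ _ z.2
  have hγt : γ t = D.sec i k p := by
    simp only [γ, z]; rw [← frameAmb_mul, mul_inv_cancel, frameAmb_one]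
  have hγ : HasDerivAt γ (α • genAmb b θ (γ t)) t := hasDerivAt_frameAmb b θ α z.1 t
  obtain ⟨r₁, r₂, hr⟩ := D.hasDerivAt_sec_coord i k hγ hγL hp hγt
  -- the velocity of the flow line in the preferred chart
  have hc : ∀ s, D.frameAct b θ (Circle.exp (α * s)) x = D.proj ⟨γ s, hγL s⟩ := by
    intro s; rw [← hzx]; rfl
  have hmd : MDifferentiableAt 𝓘(ℝ, ℝ) 𝓘(ℝ, Model m)
      (fun s : ℝ => D.frameAct b θ (Circle.exp (α * s)) x) t :=
    (hΦ.comp (contMDiff_id.prodMk contMDiff_const)).mdifferentiableAt (by simp)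
  set X : Model m := mfderiv 𝓘(ℝ, ℝ) 𝓘(ℝ, Model m)
    (fun s : ℝ => D.frameAct b θ (Circle.exp (α * s)) x) t (1 : ℝ) with hXdef
  have hX' : HasDerivAt (fun s => D.coord i k (γ s)) X t := by
    refine (hasDerivAt_chartAt_curve hmd hXdef).congr_of_eventuallyEq
      (Filter.Eventually.of_forall fun s => ?_)
    change D.chartFun i k (D.proj ⟨γ s, hγL s⟩) =
      D.chartFun i k (D.frameAct b θ (Circle.exp (α * s)) x)
    rw [hc]
  have hsX : fderiv ℝ (D.sec i k) p X = α • genAmb b θ (D.sec i k p) +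
      D.gaugeVec r₁ r₂ (D.sec i k p) := by
    have hpt : D.coord i k (γ t) = p := by rw [hγt, D.coord_sec i k hp]
    have h1 : HasFDerivAt (D.sec i k) (fderiv ℝ (D.sec i k) p) (D.coord i k (γ t)) := by
      rw [hpt]; exact ((D.contDiffAt_sec i k hp).differentiableAt (by simp)).hasFDerivAt
    have h2 := h1.comp_hasDerivAt t hX'
    have h3 := h2.unique hr
    rwa [hγt] at h3
  have hline := D.hasDerivAt_sec_line i k hp v
  have horth : stdForm m (D.gaugeVec r₁ r₂ (D.sec i k p)) (fderiv ℝ (D.sec i k) p v) = 0 := by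
    have h1 : ContinuousAt (fun s : ℝ => p + s • v) 0 := by fun_prop
    have h2 := D.stdForm_gaugeVec hline
      ((h1.eventually_mem ((D.isOpen_chartTarget i k).mem_nhds (by simpa using hp))).mono
        fun s hs => D.sec_mem i k hs) r₁ r₂
    simpa using h2
  have hlhs : D.symp y X v = stdForm m (fderiv ℝ (D.sec i k) p X) (fderiv ℝ (D.sec i k) p v) :=
    rfl
  obtain ⟨d, hd⟩ : ∃ d : ℝ, d = mfderiv 𝓘(ℝ, Model m) 𝓘(ℝ, ℝ) (fun x => α * D.ham b θ x) y v :=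
    ⟨_, rfl⟩
  have hrhs : d = α * stdForm m (genAmb b θ (D.sec i k p)) (fderiv ℝ (D.sec i k) p v) := by
    have h1 := hasDerivAt_chartAt_line
      ((contMDiff_const.mul (D.contMDiff_ham b θ)).mdifferentiableAt (by simp) :
        MDifferentiableAt 𝓘(ℝ, Model m) 𝓘(ℝ, ℝ) (fun x => α * D.ham b θ x) y) v hd
    exact h1.unique ((hasDerivAt_chartAt_line ((D.contMDiff_ham b θ).mdifferentiableAt
      (by simp)) v (D.mfderiv_ham b θ y v).symm).const_mul α)
  refine hlhs.trans (Eq.trans ?_ hd)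
  rw [hrhs, hsX, map_add, LinearMap.add_apply, horth, add_zero, map_smul, LinearMap.smul_apply,
    smul_eq_mul]

end PolytopeData

end Hamiltonian

/-! ### The homotopy -/

namespace PolytopeData

variable {m : ℕ} (D : PolytopeData m)

/-- The circle action `frameAct` as a Hamiltonian circle action. -/
def frameHamAction (b : Fin (m + 1) → ℤ) (θ : ℝ) : HamAction D.symp where
  toFun c := ⟨D.frameDiffeo b θ c, D.frameDiffeo_isHamiltonian b θ c⟩
  map_one := D.frameAct_one b θ
  map_mul := D.frameAct_mul b θ
  smooth := (D.contMDiff_frameAct b).comp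
    ((contMDiff_const.prodMk contMDiff_fst).prodMk contMDiff_snd)

theorem frameHamAction_apply (b : Fin (m + 1) → ℤ) (θ : ℝ) (c : Circle) (x : D.Toric) :
    ((D.frameHamAction b θ).toFun c).1 x = D.frameAct b θ c x := rfl

theorem continuous_frameHamAction (b : Fin (m + 1) → ℤ) :
    Continuous (fun q : ℝ × Circle => (D.frameHamAction b q.1).toFun q.2) := by
  -- pull back along the open quotient map `(θ, α) ↦ (θ, e^{iα})`, whose source is a normed space
  have hq : IsOpenQuotientMap (Prod.map id Circle.exp : ℝ × ℝ → ℝ × Circle) :=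
    IsOpenQuotientMap.id.prodMap ⟨fun c => ⟨_, Circle.exp_arg c⟩, Circle.exp.continuous,
      isLocalHomeomorph_circleExp.isOpenMap⟩
  rw [hq.isQuotientMap.continuous_iff, continuous_induced_rng]
  refine continuous_smoothTopology
    (fun q : ℝ × ℝ => D.frameDiffeo b q.1 (Circle.exp q.2)) ?_
  exact (D.contMDiff_frameAct b).comp (((contDiff_fst.contMDiff.comp contMDiff_fst).prodMk
    (contMDiff_circleExp.comp (contDiff_snd.contMDiff.comp contMDiff_fst))).prodMk contMDiff_snd)

theorem homotopic_frameAct (b : Fin (m + 1) → ℤ) (κ : ℝ) :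
    HomotopicThroughActions D.symp (D.frameAct b 0) (D.frameAct b κ) := by
  have hpar : Continuous fun q : unitInterval × Circle => ((q.1 : ℝ) * κ, q.2) := by fun_prop
  have hcont := (D.continuous_frameHamAction b).comp hpar
  refine ⟨fun s => D.frameHamAction b (s * κ), hcont, fun c x => ?_, fun c x => ?_⟩
  · rw [frameHamAction_apply, Set.Icc.coe_zero, zero_mul]
  · rw [frameHamAction_apply, Set.Icc.coe_one, one_mul]

end PolytopeData

end HamTorus

end

theorem theorem1p5 (m : ℕ) (D : HamTorus.PolytopeData m) (b b' : Fin (m + 1) → ℤ)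
    (h : D.LatticeEquiv b b') :
    HamTorus.HomotopicThroughActions D.symp (D.circleAct b) (D.circleAct b') := by
  have h0 : D.frameAct b 0 = D.circleAct b := funext (D.frameAct_zero b)
  rcases h with rfl | ⟨h, h'⟩
  · simpa only [h0] using D.homotopic_frameAct b 0
  · have h1 : D.frameAct b (Real.pi / 2) = D.circleAct b' := funext (D.frameAct_pi_div_two h h')
    simpa only [h0, h1] using D.homotopic_frameAct b (Real.pi / 2)
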